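/- Let $G$ be a discrete group. A compact $G$-space is a nonempty compact Hausdorff space on which $G$ acts by homeomorphisms; $G$ acts on $C(X)=C(X,\mathbb{C})$ by $(sf)(x)=f(s^{-1}x)$. It is minimal if every orbit is dense, strongly proximal if for every regular Borel probability measure $\nu$ on $X$ the weak* closure of $G\nu$ contains a point mass, and a $G$-boundary if it is minimal and strongly proximal. A Furstenberg boundary $\partial_F G$ of $G$ is a $G$-boundary of which every $G$-boundary is a continuous $G$-equivariant image. An operator system is a unital self-adjoint subspace of a nonzero unital C*-algebra; a $G$-operator system is an operator system with an action of $G$ by linear order isomorphisms. All maps between operator systems are linear. A $G$-operator system $\mathcal U$ is $G$-injective if for all $G$-operator systems $\mathcal S,\mathcal T$, every unital completely isometric $G$-equivariant map $\iota:\mathcal S\to\mathcal T$ and every unital completely positive $G$-equivariant map $\psi:\mathcal S\to\mathcal U$, there is a unital completely positive $G$-equivariant map $\hat\psi:\mathcal T\to\mathcal U$ with $\hat\psi\iota=\psi$; injectivity of an operator system is the same property without group actions. **Theorem.** The group $G$ has a Furstenberg boundary. For every Furstenberg boundary $\partial_F G$ of $G$, the algebra $C(\partial_F G)$ is $G$-injective,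 and it is injective. Moreover: 1. Every unital positive $G$-equivariant map from $C(\partial_F G)$ into a $G$-operator system $\mathcal S$ is completely isometric. 2. The only unital positive $G$-equivariant map from $C(\partial_F G)$ to itself is the identity map. 3. If $B$ is a $G$-boundary, then there is a unique unital positive $G$-equivariant map from $C(B)$ to $C(\partial_F G)$, and it is a unital injective *-homomorphism. 4. If $M$ is a minimal compact $G$-space, then there is at most one unital positive $G$-equivariant map from $C(\partial_F G)$ to $C(M)$, and if such a map exists, then it is a unital injective *-homomorphism. -/

import Mathlib

open scoped ComplexOrder

universe u v w₁ w₂ w₃ w₄ w₅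

/-! ### Compact `G`-spaces and boundaries -/

/-- The `G`-action on `X` is strongly proximal: for every regular Borel probability measure `ν`
on `X`, the weak* closure of the orbit `G ν` contains a point mass. -/
def IsStronglyProximal (G : Type*) [Group G] (X : Type*) [TopologicalSpace X] [MulAction G X]
    [ContinuousConstSMul G X] : Prop :=
  letI : MeasurableSpace X := borel X
  haveI : BorelSpace X := ⟨rfl⟩
  ∀ ν : MeasureTheory.ProbabilityMeasure X, (ν : MeasureTheory.Measure X).Regular →
    ∃ x : X, MeasureTheory.diracProba x ∈
      closure (Set.range fun s : G =>
        ν.map ((continuous_const_smul s : Continuous fun y : X => s • y).measurable.aemeasurable))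

/-- A `G`-boundary: a nonempty compact Hausdorff `G`-space on which the action is minimal and
strongly proximal. -/
structure IsGBoundary (G : Type*) [Group G] (X : Type*) [TopologicalSpace X] [MulAction G X]
    [ContinuousConstSMul G X] : Prop where
  nonempty : Nonempty X
  compact : CompactSpace X
  t2 : T2Space X
  minimal : MulAction.IsMinimal G X
  stronglyProximal : IsStronglyProximal G X

/-- `X` is the Furstenberg boundary of `G`: it is a `G`-boundary, and every `G`-boundary is a
continuous `G`-equivariant image of it. Every `G`-boundary is a quotient of the Stone-Čech
compactification of `G`, so up to isomorphism all of them occur in the universe of `G`. -/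
structure IsFurstenbergBoundary (G : Type u) [Group G] (X : Type v) [TopologicalSpace X]
    [MulAction G X] [ContinuousConstSMul G X] : Prop where
  isGBoundary : IsGBoundary G X
  universal : ∀ (B : Type u) [TopologicalSpace B] [MulAction G B] [ContinuousConstSMul G B],
    IsGBoundary G B →
      ∃ f : X → B, Continuous f ∧ Function.Surjective f ∧ ∀ (s : G) (x : X), f (s • x) = s • f x

/-- The action of `G` on functions, `(s f)(x) = f (s⁻¹ x)`. -/
noncomputable def translateFun {G : Type*} [Group G] {X : Type*} [TopologicalSpace X] [MulAction G X]
    [ContinuousConstSMul G X] (s : G) (f : C(X, ℂ)) : C(X, ℂ) :=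
  ⟨fun x => f (s⁻¹ • x), f.continuous.comp (continuous_const_smul s⁻¹)⟩

/-! ### Operator systems -/

/-- An operator system: a unital self-adjoint subspace of a unital C*-algebra `A`. -/
structure OperatorSystem (A : Type*) [CStarAlgebra A] extends Submodule ℂ A where
  one_mem' : (1 : A) ∈ carrier
  star_mem' : ∀ {a : A}, a ∈ carrier → star a ∈ carrier

namespace OperatorSystem

variable {A B : Type*} [CStarAlgebra A] [CStarAlgebra B]

/-- The underlying vector space of an operator system. -/
abbrev Space (S : OperatorSystem A) : Type _ := S.toSubmodule

/-- The unit of an operator system. -/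
def unit (S : OperatorSystem A) : S.Space := ⟨1, S.one_mem'⟩

/-- A matrix over the operator system `S ⊆ A`, seen in the C*-algebra of matrices over `A`. -/
def toCStarMatrix (S : OperatorSystem A) {n : ℕ} (M : Matrix (Fin n) (Fin n) S.Space) :
    CStarMatrix (Fin n) (Fin n) A :=
  CStarMatrix.ofMatrix (M.map fun x => (x : A))

/-- The linear map `φ` sends the unit to the unit. -/
def IsUnital {S : OperatorSystem A} {T : OperatorSystem B} (φ : S.Space →ₗ[ℂ] T.Space) : Prop :=
  φ S.unit = T.unit

/-- The linear map `φ` is positive. -/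
def IsPositive [PartialOrder A] [PartialOrder B] {S : OperatorSystem A} {T : OperatorSystem B}
    (φ : S.Space →ₗ[ℂ] T.Space) : Prop :=
  ∀ x : S.Space, 0 ≤ (x : A) → 0 ≤ (φ x : B)

/-- The linear map `φ` is completely positive. -/
def IsCompletelyPositive [PartialOrder A] [StarOrderedRing A] [PartialOrder B] [StarOrderedRing B]
    {S : OperatorSystem A} {T : OperatorSystem B} (φ : S.Space →ₗ[ℂ] T.Space) : Prop :=
  ∀ (n : ℕ) (M : Matrix (Fin n) (Fin n) S.Space),
    0 ≤ S.toCStarMatrix M → 0 ≤ T.toCStarMatrix (M.map φ)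

/-- The linear map `φ` is completely isometric. -/
def IsCompletelyIsometric [PartialOrder A] [StarOrderedRing A] [PartialOrder B]
    [StarOrderedRing B] {S : OperatorSystem A} {T : OperatorSystem B}
    (φ : S.Space →ₗ[ℂ] T.Space) : Prop :=
  ∀ (n : ℕ) (M : Matrix (Fin n) (Fin n) S.Space),
    ‖T.toCStarMatrix (M.map φ)‖ = ‖S.toCStarMatrix M‖

/-- Injectivity in the category of operator systems and unital completely positive maps. -/
def IsInjective {D : Type u} [CStarAlgebra D] [PartialOrder D] [StarOrderedRing D]
    (U : OperatorSystem D) : Prop :=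
  ∀ (A : Type w₁) [CStarAlgebra A] [PartialOrder A] [StarOrderedRing A]
    (B : Type w₂) [CStarAlgebra B] [PartialOrder B] [StarOrderedRing B]
    (S : OperatorSystem A) (T : OperatorSystem B)
    (ι : S.Space →ₗ[ℂ] T.Space) (ψ : S.Space →ₗ[ℂ] U.Space),
    IsUnital ι → IsCompletelyIsometric ι → IsUnital ψ → IsCompletelyPositive ψ →
      ∃ ψ' : T.Space →ₗ[ℂ] U.Space,
        IsUnital ψ' ∧ IsCompletelyPositive ψ' ∧ ψ' ∘ₗ ι = ψ

end OperatorSystem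

/-- A `G`-operator system: an operator system with an action of `G` by linear order isomorphisms
(each `s` acts by a positive map with positive inverse, the action of `s⁻¹`). -/
structure GOperatorSystem (G : Type*) [Group G] (A : Type*) [CStarAlgebra A] [PartialOrder A]
    extends OperatorSystem A where
  act : Representation ℂ G toSubmodule
  act_nonneg : ∀ (s : G) (x : toSubmodule), 0 ≤ (x : A) → 0 ≤ (act s x : A)

namespace GOperatorSystem

open OperatorSystem

variable {G : Type*} [Group G] {A B : Type*} [CStarAlgebra A] [PartialOrder A]
  [CStarAlgebra B] [PartialOrder B]

/-- The linear map `φ` commutes with the `G`-actions. -/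
def IsEquivariant {S : GOperatorSystem G A} {T : GOperatorSystem G B}
    (φ : S.Space →ₗ[ℂ] T.Space) : Prop :=
  ∀ (s : G) (x : S.Space), φ (S.act s x) = T.act s (φ x)

/-- `G`-injectivity of a `G`-operator system. -/
def IsGInjective {G : Type u} [Group G] {D : Type v} [CStarAlgebra D]
    [PartialOrder D] [StarOrderedRing D] (U : GOperatorSystem G D) : Prop :=
  ∀ (A : Type w₁) [CStarAlgebra A] [PartialOrder A] [StarOrderedRing A]
    (B : Type w₂) [CStarAlgebra B] [PartialOrder B] [StarOrderedRing B]
    (S : GOperatorSystem G A) (T : GOperatorSystem G B)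
    (ι : S.Space →ₗ[ℂ] T.Space) (ψ : S.Space →ₗ[ℂ] U.Space),
    IsUnital ι → IsCompletelyIsometric ι → IsEquivariant ι →
    IsUnital ψ → IsCompletelyPositive ψ → IsEquivariant ψ →
      ∃ ψ' : T.Space →ₗ[ℂ] U.Space,
        IsUnital ψ' ∧ IsCompletelyPositive ψ' ∧ IsEquivariant ψ' ∧ ψ' ∘ₗ ι = ψ

/-- The algebra `C(X)` of a compact `G`-space `X`, as a `G`-operator system. -/
noncomputable def ofSpace (G : Type*) [Group G] (X : Type*) [TopologicalSpace X] [CompactSpace X]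
    [MulAction G X] [ContinuousConstSMul G X] : GOperatorSystem G C(X, ℂ) where
  toSubmodule := ⊤
  one_mem' := trivial
  star_mem' := fun _ => trivial
  act :=
    { toFun := fun s =>
        { toFun := fun f => ⟨translateFun s f.1, trivial⟩
          map_add' := fun _ _ => rfl
          map_smul' := fun _ _ => rfl }
      map_one' := by
        ext f x
        simp [translateFun]
      map_mul' := fun s t => by
        ext f x
        simp [translateFun, mul_smul] }
  act_nonneg := fun s f hf x => hf (s⁻¹ • x)

end GOperatorSystem

/-! ### Maps between algebras of continuous functions -/

/-- `φ : C(X) → C(Y)` is a unital positive `G`-equivariant linear map. -/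
structure IsUnitalPositiveEquivariant (G : Type*) [Group G] {X Y : Type*}
    [TopologicalSpace X] [MulAction G X] [ContinuousConstSMul G X]
    [TopologicalSpace Y] [MulAction G Y] [ContinuousConstSMul G Y]
    (φ : C(X, ℂ) →ₗ[ℂ] C(Y, ℂ)) : Prop where
  map_one : φ 1 = 1
  map_nonneg : ∀ f : C(X, ℂ), 0 ≤ f → 0 ≤ φ f
  equivariant : ∀ (s : G) (f : C(X, ℂ)), φ (translateFun s f) = translateFun s (φ f)

/-- `φ` is a unital injective *-homomorphism. -/
def IsInjectiveStarHom {X Y : Type*} [TopologicalSpace X] [TopologicalSpace Y]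
    (φ : C(X, ℂ) →ₗ[ℂ] C(Y, ℂ)) : Prop :=
  Function.Injective φ ∧ ∃ Φ : C(X, ℂ) →⋆ₐ[ℂ] C(Y, ℂ), ∀ f, Φ f = φ f

/-! Everything is dual: a unital positive map into `C(X)` is a continuous family of states indexed
by `X`, and an equivariant map is an equivariant family. Three facts about compact convex `G`-spaces
carry the proof.

Glasner's lemma (`IsConvexGSet.exists_boundary`): in a minimal compact convex `G`-space, the orbit
closure of an extreme point is a boundary. Krein-Milman and Milman's converse give this through
barycenters. Applied to the states of the bounded functions on `G`, it yields a boundary that maps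
onto every other one: an orbit map into a boundary `B` pulls `C(B)` back to bounded functions, hence
pushes states forward to states of `C(B)`.

Rigidity (`IsGBoundary.exists_map_of_states`): if `X` is a boundary, an equivariant continuous map
from a minimal space to the states of `C(X)` takes only point evaluations as values. Strong
proximality puts one evaluation in its compact image, and minimality spreads this to all points. So
positive equivariant maps out of `C(X)` are compositions with surjections. Two of them agree because
their average is again multiplicative.

Fixed-point property (`IsFurstenbergBoundary.exists_map_convex`): the Furstenberg boundary maps
equivariantly into every compact convex `G`-space. For injectivity, the space consists of pairs of a
state of the larger system (or a `G`-indexed family of such states) and a state of `C(X)` that are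
compatible over the smaller system. Rigidity forces the second coordinate to be evaluation, so the
first coordinate is the extension. For complete isometry, the space is the state space of the
target: rigidity makes the resulting family of states a left inverse of the given map. Complete
positivity and contractivity come for free because `C(X)` is commutative. -/

/-! ### States of operator systems -/

namespace OperatorSystem

variable {A B : Type*} [CStarAlgebra A] [CStarAlgebra B]

/-- A C*-algebra, as an operator system in itself. -/
noncomputable def whole (A : Type*) [CStarAlgebra A] : OperatorSystem A where
  toSubmodule := ⊤
  one_mem' := trivial
  star_mem' := fun _ => trivial

section Order

variable [PartialOrder A] [StarOrderedRing A] [PartialOrder B] [StarOrderedRing B]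

/-- Both claims come from positivity of `‖x‖ • 1 - x`, since `0 ≤ z` in `ℂ` includes that `z` is
real. -/
theorem im_eq_zero_of_positive (S : OperatorSystem A) (L : S.Space →ₗ[ℂ] ℂ)
    (h1 : L S.unit = 1) (hL : ∀ x : S.Space, 0 ≤ (x : A) → 0 ≤ L x)
    (x : S.Space) (hx : IsSelfAdjoint (x : A)) : (L x).im = 0 ∧ (L x).re ≤ ‖x‖ := by
  have h : 0 ≤ L ((‖x‖ : ℂ) • S.unit - x) := by
    apply hL
    have := hx.le_algebraMap_norm_self
    rw [Algebra.algebraMap_eq_smul_one] at this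
    simpa [unit] using this
  rw [map_sub, map_smul, h1, Complex.le_def] at h
  simp at h
  exact ⟨h.2, h.1⟩

/-- The elements `x + x*` and `i (x - x*)` are self-adjoint, so `L` is real on both. -/
theorem map_star_of_positive (S : OperatorSystem A) (L : S.Space →ₗ[ℂ] ℂ)
    (h1 : L S.unit = 1) (hL : ∀ x : S.Space, 0 ≤ (x : A) → 0 ≤ L x) (x : S.Space) :
    L ⟨star (x : A), S.star_mem' x.2⟩ = star (L x) := by
  let y : S.Space := ⟨star (x : A), S.star_mem' x.2⟩
  have ha := (S.im_eq_zero_of_positive L h1 hL (x + y) (by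
    change star ((x : A) + star (x : A)) = (x : A) + star (x : A)
    rw [star_add, star_star, add_comm])).1
  have hb := (S.im_eq_zero_of_positive L h1 hL (Complex.I • (x - y)) (by
    change star (Complex.I • ((x : A) - star (x : A))) = Complex.I • ((x : A) - star (x : A))
    rw [star_smul, star_sub, star_star]
    simp only [Complex.star_def, Complex.conj_I, smul_sub, neg_smul]
    abel)).1
  rw [map_add, Complex.add_im] at ha
  rw [map_smul, map_sub, smul_eq_mul, Complex.I_mul_im, Complex.sub_re] at hb
  apply Complex.ext
  · change (L y).re = (L x).re
    linarith
  · change (L y).im = -(L x).im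
    linarith

/-- A unital positive functional on an operator system is contractive. -/
theorem norm_le_of_positive (S : OperatorSystem A) (L : S.Space →ₗ[ℂ] ℂ)
    (h1 : L S.unit = 1) (hL : ∀ x : S.Space, 0 ≤ (x : A) → 0 ≤ L x)
    (x : S.Space) : ‖L x‖ ≤ ‖x‖ := by
  -- Rotating `x` by a phase makes `L y = ‖L x‖` real. Then `L (y + y*) = 2 ‖L x‖`, while `‖y + y*‖
  -- ≤ 2 ‖x‖`.
  obtain ⟨c, hc, hcx⟩ : ∃ c : ℂ, ‖c‖ = 1 ∧ c * L x = ‖L x‖ := by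
    by_cases h : L x = 0
    · exact ⟨1, by simp, by simp [h]⟩
    · refine ⟨(‖L x‖ : ℂ) / L x, ?_, ?_⟩
      · simp [h]
      · field_simp
  set y : S.Space := c • x with hy
  have hyn : ‖y‖ = ‖x‖ := by rw [hy, norm_smul, hc, one_mul]
  have hLy : L y = ‖L x‖ := by rw [hy, map_smul, smul_eq_mul, hcx]
  let ys : S.Space := ⟨star (y : A), S.star_mem' y.2⟩
  have hys : ‖ys‖ = ‖y‖ := by
    change ‖star (y : A)‖ = ‖(y : A)‖
    exact norm_star _
  have ha := S.im_eq_zero_of_positive L h1 hL (y + ys) (by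
    change star ((y : A) + star (y : A)) = (y : A) + star (y : A)
    rw [star_add, star_star, add_comm])
  have h3 := ha.2
  rw [map_add, S.map_star_of_positive L h1 hL, hLy, Complex.star_def, Complex.conj_ofReal,
    Complex.add_re, Complex.ofReal_re] at h3
  have h4 : ‖y + ys‖ ≤ ‖x‖ + ‖x‖ := by
    refine (norm_add_le _ _).trans ?_
    rw [hys, hyn]
  linarith

/-- A unital contractive functional on an operator system is positive. -/
theorem nonneg_of_norm_le (S : OperatorSystem A) (L : S.Space →ₗ[ℂ] ℂ)
    (h1 : L S.unit = 1) (hL : ∀ x : S.Space, ‖L x‖ ≤ ‖x‖)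
    (x : S.Space) (hx : 0 ≤ (x : A)) : 0 ≤ L x := by
  have hsa : IsSelfAdjoint (x : A) := .of_nonneg hx
  have him : (L x).im = 0 := by
    -- Shift by `i t`: the C*-identity gives `‖x + i t‖² ≤ ‖x‖² + t²`, whereas `|L x + i t|²`
    -- contains the term `2 t · im (L x)`. As `t` is arbitrary, the imaginary part vanishes.
    have key : ∀ t : ℝ, 2 * t * (L x).im ≤ ‖x‖ ^ 2 := by
      intro t
      have ht := hL (x + ((t : ℂ) * Complex.I) • S.unit)
      rw [map_add, map_smul, h1] at ht
      have hn : ‖x + ((t : ℂ) * Complex.I) • S.unit‖ ^ 2 ≤ ‖x‖ ^ 2 + t ^ 2 := by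
        change ‖(x : A) + ((t : ℂ) * Complex.I) • (1 : A)‖ ^ 2 ≤ ‖(x : A)‖ ^ 2 + t ^ 2
        rw [pow_two, ← CStarRing.norm_star_mul_self]
        have : star ((x : A) + ((t : ℂ) * Complex.I) • (1 : A)) *
            ((x : A) + ((t : ℂ) * Complex.I) • (1 : A)) =
            (x : A) * x + ((t ^ 2 : ℝ) : ℂ) • (1 : A) := by
          rw [star_add, hsa.star_eq, star_smul]
          simp only [star_one, mul_add, add_mul, smul_mul_assoc, one_mul, mul_smul_comm, mul_one,
            smul_smul, smul_add]
          simp only [star_mul', Complex.star_def, Complex.conj_ofReal, Complex.conj_I]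
          rw [show (t : ℂ) * -Complex.I = -(t * Complex.I) by ring, neg_smul]
          rw [show (t : ℂ) * Complex.I * -(t * Complex.I) = ((t ^ 2 : ℝ) : ℂ) by
            push_cast; linear_combination (-(t : ℂ) ^ 2) * Complex.I_sq]
          abel
        rw [this]
        refine (norm_add_le _ _).trans ?_
        gcongr
        · rw [pow_two]; exact norm_mul_le _ _
        · rw [norm_smul]
          rcases subsingleton_or_nontrivial A with h | h
          · simp [Subsingleton.elim (1 : A) 0, sq_nonneg]
          · simp
      have hsq : ‖L x + ((t : ℂ) * Complex.I) • 1‖ ^ 2 = (L x).re ^ 2 + ((L x).im + t) ^ 2 := by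
        rw [Complex.sq_norm, Complex.normSq_apply]
        simp
        ring
      have := pow_le_pow_left₀ (norm_nonneg _) ht 2
      rw [hsq] at this
      nlinarith [sq_nonneg (L x).re, sq_nonneg (L x).im]
    by_contra hne
    have := key ((‖x‖ ^ 2 + 1) / (2 * (L x).im))
    rw [show 2 * ((‖x‖ ^ 2 + 1) / (2 * (L x).im)) * (L x).im = ‖x‖ ^ 2 + 1 by
      field_simp] at this
    linarith
  have hle := hL ((‖x‖ : ℂ) • S.unit - x)
  -- Since `0 ≤ ‖x‖ - x ≤ ‖x‖`, contractivity gives `‖x‖ - re (L x) ≤ ‖x‖`.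
  have hn : ‖(‖x‖ : ℂ) • S.unit - x‖ ≤ ‖x‖ := by
    change ‖(‖(x : A)‖ : ℂ) • (1 : A) - x‖ ≤ ‖(x : A)‖
    have h0 : 0 ≤ (‖(x : A)‖ : ℂ) • (1 : A) - x := by
      have := hsa.le_algebraMap_norm_self
      rw [Algebra.algebraMap_eq_smul_one] at this
      simpa using this
    refine (CStarAlgebra.norm_le_iff_le_algebraMap _ (norm_nonneg _) h0).2 ?_
    rw [Algebra.algebraMap_eq_smul_one]
    simpa using hx
  have hre : ‖x‖ - (L x).re ≤ ‖x‖ := by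
    rw [map_sub, map_smul, h1] at hle
    refine le_trans ?_ (hle.trans hn)
    refine le_trans (le_of_eq ?_) (Complex.re_le_norm _)
    simp
  rw [Complex.le_def]
  exact ⟨by simpa using hre, by simp [him]⟩

/-- States extend along unital isometric embeddings of operator systems. -/
theorem exists_state_extension (S : OperatorSystem A) (T : OperatorSystem B)
    (ι : S.Space →ₗ[ℂ] T.Space) (hι1 : IsUnital ι) (hι : ∀ x, ‖ι x‖ = ‖x‖)
    (L : S.Space →ₗ[ℂ] ℂ) (h1 : L S.unit = 1)
    (hL : ∀ x : S.Space, 0 ≤ (x : A) → 0 ≤ L x) :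
    ∃ L' : T.Space →ₗ[ℂ] ℂ, L' T.unit = 1 ∧ (∀ x : T.Space, 0 ≤ (x : B) → 0 ≤ L' x) ∧
      ∀ x, L' (ι x) = L x := by
  let ιi : S.Space →ₗᵢ[ℂ] T.Space := ⟨ι, hι⟩
  let e := ιi.equivRange
  let f : LinearMap.range ιi.toLinearMap →ₗ[ℂ] ℂ := L ∘ₗ e.symm.toLinearMap
  have hf : ∀ y, ‖f y‖ ≤ 1 * ‖y‖ := fun y => by
    rw [one_mul]
    refine (S.norm_le_of_positive L h1 hL _).trans (le_of_eq ?_)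
    exact e.symm.norm_map y
  -- The Hahn-Banach extension keeps the norm, so it is unital and contractive. Positivity then
  -- comes from `nonneg_of_norm_le`.
  obtain ⟨g, hg, hgn⟩ := exists_extension_norm_eq (𝕜 := ℂ) _ (f.mkContinuous 1 hf)
  have hgι : ∀ x, g (ι x) = L x := by
    intro x
    have := hg (e x)
    change g (ι x) = L (e.symm (e x)) at this
    rwa [e.symm_apply_apply] at this
  have hg1 : g T.unit = 1 := by rw [← hι1, hgι, h1]
  refine ⟨g.toLinearMap, hg1, ?_, hgι⟩
  refine T.nonneg_of_norm_le g.toLinearMap hg1 fun x => ?_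
  refine (g.le_opNorm x).trans ?_
  rw [hgn]
  have := LinearMap.mkContinuous_norm_le f zero_le_one hf
  nlinarith [norm_nonneg x]

end Order

end OperatorSystem

/-! ### State spaces -/

/-- The unital contractive functionals on `V` that are nonnegative on `P`, as functions with the
topology of pointwise convergence. -/
def stateSet {V : Type*} [NormedAddCommGroup V] [NormedSpace ℂ V] (e : V) (P : Set V) :
    Set (V → ℂ) :=
  {l | (∀ x y, l (x + y) = l x + l y) ∧ (∀ (c : ℂ) x, l (c • x) = c * l x) ∧ l e = 1 ∧
    (∀ x ∈ P, 0 ≤ l x) ∧ ∀ x, ‖l x‖ ≤ ‖x‖}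

section StateSet

variable {V : Type*} [NormedAddCommGroup V] [NormedSpace ℂ V] {e : V} {P : Set V}

theorem isClosed_stateSet : IsClosed (stateSet e P) := by
  have hc : ∀ x : V, Continuous fun l : V → ℂ => l x := continuous_apply
  refine IsClosed.and ?_ (IsClosed.and ?_ (IsClosed.and ?_ (IsClosed.and ?_ ?_)))
  · simp only [Set.ofPred_forall]
    exact isClosed_iInter fun x => isClosed_iInter fun y => isClosed_eq (hc _) ((hc _).add (hc _))
  · simp only [Set.ofPred_forall]
    exact isClosed_iInter fun c => isClosed_iInter fun x =>
      isClosed_eq (hc _) (continuous_const.mul (hc _))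
  · exact isClosed_eq (hc _) continuous_const
  · simp only [Set.ofPred_forall]
    exact isClosed_iInter fun x => isClosed_iInter fun _ => isClosed_le continuous_const (hc _)
  · simp only [Set.ofPred_forall]
    exact isClosed_iInter fun x => isClosed_le (hc _).norm continuous_const

/-- The norm clause of `stateSet` places it in a product of closed discs, so Tychonoff applies. -/
theorem isCompact_stateSet : IsCompact (stateSet e P) := by
  refine IsCompact.of_isClosed_subset
    (isCompact_univ_pi fun x : V => isCompact_closedBall (0 : ℂ) ‖x‖) isClosed_stateSet ?_
  intro l hl x _
  simpa using hl.2.2.2.2 x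

theorem convex_stateSet : Convex ℝ (stateSet e P) := by
  intro l hl m hm a b ha hb hab
  have hab' : (a : ℂ) + b = 1 := by exact_mod_cast hab
  refine ⟨fun x y => ?_, fun c x => ?_, ?_, fun x hx => ?_, fun x => ?_⟩
  · simp only [Pi.add_apply, Pi.smul_apply, hl.1, hm.1, smul_add]
    abel
  · simp only [Pi.add_apply, Pi.smul_apply, hl.2.1, hm.2.1, Complex.real_smul]
    ring
  · simpa [hl.2.2.1, hm.2.2.1] using hab'
  · exact add_nonneg (smul_nonneg ha (hl.2.2.2.1 x hx)) (smul_nonneg hb (hm.2.2.2.1 x hx))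
  · calc ‖a • l x + b • m x‖ ≤ a * ‖l x‖ + b * ‖m x‖ := by
          refine (norm_add_le _ _).trans ?_
          rw [norm_smul, norm_smul, Real.norm_of_nonneg ha, Real.norm_of_nonneg hb]
      _ ≤ a * ‖x‖ + b * ‖x‖ := by
          gcongr
          · exact hl.2.2.2.2 x
          · exact hm.2.2.2.2 x
      _ = ‖x‖ := by rw [← add_mul, hab, one_mul]

/-- The linear functional underlying an element of `stateSet`. -/
def stateSet.toLinearMap {l : V → ℂ} (hl : l ∈ stateSet e P) : V →ₗ[ℂ] ℂ where
  toFun := l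
  map_add' := hl.1
  map_smul' := hl.2.1

end StateSet

/-- The states of an operator system. -/
def OperatorSystem.states {A : Type*} [CStarAlgebra A] [PartialOrder A] (S : OperatorSystem A) :
    Set (S.Space → ℂ) :=
  stateSet S.unit {x | 0 ≤ (x : A)}

theorem OperatorSystem.mem_states {A : Type*} [CStarAlgebra A] [PartialOrder A] [StarOrderedRing A]
    (S : OperatorSystem A) (L : S.Space →ₗ[ℂ] ℂ) (h1 : L S.unit = 1)
    (hL : ∀ x : S.Space, 0 ≤ (x : A) → 0 ≤ L x) : (L : S.Space → ℂ) ∈ S.states :=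
  ⟨map_add L, map_smul L, h1, hL, S.norm_le_of_positive L h1 hL⟩

/-- The states of the algebra of continuous functions on a compact space. -/
def functionStates (X : Type*) [TopologicalSpace X] [CompactSpace X] : Set (C(X, ℂ) → ℂ) :=
  stateSet 1 {f | 0 ≤ f}

/-! ### Extreme states of `C(X)` -/

section FunctionStates

variable {X : Type*} [TopologicalSpace X] [CompactSpace X]

theorem mem_functionStates (L : C(X, ℂ) →ₗ[ℂ] ℂ) (h1 : L 1 = 1)
    (hL : ∀ f : C(X, ℂ), 0 ≤ f → 0 ≤ L f) : (L : C(X, ℂ) → ℂ) ∈ functionStates X :=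
  ⟨map_add L, map_smul L, h1, hL, fun f =>
    (OperatorSystem.whole C(X, ℂ)).norm_le_of_positive (L ∘ₗ Submodule.subtype _) h1
      (fun x hx => hL x hx) ⟨f, trivial⟩⟩

theorem eval_mem_functionStates (x : X) : (fun f : C(X, ℂ) => f x) ∈ functionStates X :=
  ⟨fun _ _ => rfl, fun _ _ => rfl, rfl, fun _ hf => hf x, fun f => f.norm_coe_le_norm x⟩

/-- An extreme state is multiplicative against functions with values in a compact subinterval of
`(0, 1)`. -/
theorem map_mul_of_extreme_of_bounds {l : C(X, ℂ) → ℂ}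
    (hl : l ∈ Set.extremePoints ℝ (functionStates X)) (f g : C(X, ℂ)) {r : ℝ} (hr : 0 < r)
    (hf0 : ∀ x, (r : ℂ) ≤ f x) (hf1 : ∀ x, (r : ℂ) ≤ 1 - f x) : l (f * g) = l f * l g := by
  have hr' : (0 : ℂ) ≤ r := by exact_mod_cast hr.le
  let L := stateSet.toLinearMap hl.1
  have hLl : ∀ h, L h = l h := fun _ => rfl
  have hL1 : L 1 = 1 := hl.1.2.2.1
  have hLpos : ∀ h : C(X, ℂ), 0 ≤ h → 0 ≤ L h := hl.1.2.2.2.1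
  have hlow : ∀ h : C(X, ℂ), (∀ x, (r : ℂ) ≤ h x) → (r : ℂ) ≤ L h := by
    intro h hh
    have : 0 ≤ L (h - (r : ℂ) • 1) := hLpos _ fun x => by simpa using hh x
    rw [map_sub, map_smul, hL1] at this
    simpa using this
  have hLf := hlow f hf0
  have hLf' : (r : ℂ) ≤ 1 - L f := by
    have := hlow (1 - f) (by simpa using hf1)
    rwa [map_sub, hL1] at this
  obtain ⟨t, ht⟩ : ∃ t : ℝ, L f = t :=
    ⟨(L f).re, by
      apply Complex.ext
      · simp
      · have := (Complex.le_def.1 hLf).2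
        simpa using this.symm⟩
  rw [ht] at hLf hLf'
  have ht0 : 0 < t := hr.trans_le (by exact_mod_cast hLf)
  have ht1 : 0 < 1 - t := hr.trans_le (by exact_mod_cast hLf')
  have ht0c : (t : ℂ) ≠ 0 := by exact_mod_cast ht0.ne'
  have ht1c : (1 - t : ℂ) ≠ 0 := by exact_mod_cast ht1.ne'
  -- Cutting `l` down by `f` and by `1 - f` and normalizing gives two states whose average with
  -- weights `t` and `1 - t` is `l`. Extremality identifies `l` with the first, which is
  -- multiplicativity. The bounds by `r` keep both weights positive.
  have mk : ∀ (h : C(X, ℂ)) (c : ℝ), 0 < c → L h = c → 0 ≤ h →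
      (fun g => (c : ℂ)⁻¹ * L (h * g)) ∈ functionStates X := by
    intro h c hc hLc hh
    refine mem_functionStates ((c : ℂ)⁻¹ • (L ∘ₗ LinearMap.mulLeft ℂ h)) ?_ ?_
    · have : (c : ℂ) ≠ 0 := by exact_mod_cast hc.ne'
      simp [hLc, this]
    · intro k hk
      have h1 : 0 ≤ L (h * k) := hLpos _ fun x => mul_nonneg (hh x) (hk x)
      have h2 : (0 : ℂ) ≤ (c : ℂ)⁻¹ := by
        rw [← Complex.ofReal_inv]
        exact_mod_cast (inv_pos.2 hc).le
      exact mul_nonneg h2 h1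
  have h1 := mk f t ht0 ht fun x => hr'.trans (hf0 x)
  have h2 := mk (1 - f) (1 - t) ht1 (by rw [map_sub, hL1, ht]; simp)
    fun x => hr'.trans (by simpa using hf1 x)
  have := (mem_extremePoints.1 hl).2 _ h1 _ h2 ⟨t, 1 - t, ht0, ht1, by ring, by
    funext k
    simp only [Pi.add_apply, Pi.smul_apply, Complex.real_smul]
    push_cast
    rw [mul_inv_cancel_left₀ ht0c, mul_inv_cancel_left₀ ht1c, sub_mul, map_sub, one_mul]
    simp [hLl]⟩
  have h3 := congrFun this.1 g
  rw [← hLl f, ht, ← hLl g, ← hLl (f * g)]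
  rw [← hLl g] at h3
  rw [← h3, mul_inv_cancel_left₀ ht0c]

/-- The identity is linear in `f` and holds for `f = 1`, so a self-adjoint `f` may be rescaled and
shifted into `[1/4, 3/4]`. -/
theorem map_mul_of_extreme {l : C(X, ℂ) → ℂ}
    (hl : l ∈ Set.extremePoints ℝ (functionStates X)) (f g : C(X, ℂ)) :
    l (f * g) = l f * l g := by
  let L := stateSet.toLinearMap hl.1
  have hL1 : L 1 = 1 := hl.1.2.2.1
  change L (f * g) = L f * L g
  have hsa : ∀ f : C(X, ℂ), IsSelfAdjoint f → L (f * g) = L f * L g := by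
    intro f hf
    set c : ℝ := 1 / (4 * (‖f‖ + 1)) with hc
    have hcpos : 0 < c := by positivity
    have hbound : ∀ x, ∃ t : ℝ, f x = t ∧ |c * t| ≤ 1 / 4 := by
      intro x
      have h1 : star (f x) = f x := congrArg (fun h : C(X, ℂ) => h x) hf.star_eq
      have h2 : f x = ((f x).re : ℂ) := (Complex.conj_eq_iff_re.1 h1).symm
      refine ⟨(f x).re, h2, ?_⟩
      have h3 : |(f x).re| ≤ ‖f‖ := (Complex.abs_re_le_norm _).trans (f.norm_coe_le_norm x)
      rw [abs_mul, abs_of_pos hcpos, hc, div_mul_eq_mul_div, one_mul,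
        div_le_div_iff₀ (by positivity) (by norm_num)]
      linarith
    have key := map_mul_of_extreme_of_bounds hl ((1 / 2 : ℂ) • 1 + (c : ℂ) • f) g
      (r := 1 / 4) (by norm_num) (fun x => by
        obtain ⟨t, h1, h2⟩ := hbound x
        have h3 : (1 / 4 : ℝ) ≤ 1 / 2 + c * t := by linarith [(abs_le.1 h2).1]
        have h4 : ((1 / 4 : ℝ) : ℂ) ≤ ((1 / 2 + c * t : ℝ) : ℂ) := by exact_mod_cast h3
        simpa [h1] using h4) (fun x => by
        obtain ⟨t, h1, h2⟩ := hbound x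
        have h3 : (1 / 4 : ℝ) ≤ 1 - (1 / 2 + c * t) := by linarith [(abs_le.1 h2).2]
        have h4 : ((1 / 4 : ℝ) : ℂ) ≤ ((1 - (1 / 2 + c * t) : ℝ) : ℂ) := by exact_mod_cast h3
        simpa [h1] using h4)
    change L (_ * g) = L _ * L g at key
    rw [add_mul, map_add, map_add, smul_mul_assoc, smul_mul_assoc, map_smul, map_smul, map_smul,
      map_smul, hL1, one_mul] at key
    have hcc : (c : ℂ) ≠ 0 := by exact_mod_cast hcpos.ne'
    simp only [smul_eq_mul] at key
    apply mul_left_cancel₀ hcc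
    linear_combination key
  have h1 := hsa (realPart f : C(X, ℂ)) (realPart f).2
  have h2 := hsa (imaginaryPart f : C(X, ℂ)) (imaginaryPart f).2
  rw [← realPart_add_I_smul_imaginaryPart f, add_mul, map_add, map_add, smul_mul_assoc, map_smul,
    map_smul, h1, h2]
  simp only [smul_eq_mul]
  ring

/-- The extreme states of `C(X)` are the point evaluations. -/
theorem exists_eq_eval_of_extreme [T2Space X] {l : C(X, ℂ) → ℂ}
    (hl : l ∈ Set.extremePoints ℝ (functionStates X)) : ∃ x : X, l = fun f => f x := by
  have hcont : Continuous (stateSet.toLinearMap hl.1) :=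
    AddMonoidHomClass.continuous_of_bound _ 1 fun f => by
      rw [one_mul]; exact hl.1.2.2.2.2 f
  let χ : WeakDual.characterSpace ℂ C(X, ℂ) :=
    ⟨(⟨stateSet.toLinearMap hl.1, hcont⟩ : C(X, ℂ) →L[ℂ] ℂ), by
      refine ⟨fun h => ?_, fun f g => map_mul_of_extreme hl f g⟩
      have h1 : l 1 = 1 := hl.1.2.2.1
      have h0 : l 1 = 0 := congrArg (fun m : WeakDual ℂ C(X, ℂ) => m 1) h
      exact one_ne_zero (h1.symm.trans h0)⟩
  obtain ⟨x, hx⟩ := (WeakDual.CharacterSpace.continuousMapEval_bijective X ℂ).2 χ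
  exact ⟨x, funext fun f => (congrArg (fun m : WeakDual.characterSpace ℂ C(X, ℂ) => m f) hx).symm⟩

end FunctionStates

/-! ### Barycenters -/

section Barycenter

variable {I : Type*} (X : Set (I → ℂ))

/-- The coordinate functions on a set of functions. -/
def coordFun (i : I) : C(X, ℂ) := ⟨fun x => x.1 i, (continuous_apply i).comp continuous_subtype_val⟩

/-- The barycenter of a functional on `C(X)`, for a set `X` of functions. -/
def barycenter : (C(X, ℂ) → ℂ) →L[ℝ] (I → ℂ) where
  toFun l i := l (coordFun X i)
  map_add' _ _ := rfl
  map_smul' _ _ := rfl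
  cont := continuous_pi fun i => continuous_apply (coordFun X i)

variable {X} {Q : Set (I → ℂ)}

/-- By Krein-Milman, states are limits of convex combinations of point evaluations, whose
barycenters are points of `X`. -/
theorem barycenter_mem [CompactSpace X] (hQ : IsClosed Q) (hQc : Convex ℝ Q) (hXQ : X ⊆ Q)
    {l : C(X, ℂ) → ℂ} (hl : l ∈ functionStates X) : barycenter X l ∈ Q := by
  have hsub : closure (convexHull ℝ ((functionStates X).extremePoints ℝ)) ⊆
      barycenter X ⁻¹' Q := by
    refine closure_minimal (convexHull_min ?_ ?_) (hQ.preimage (barycenter X).continuous)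
    · intro m hm
      obtain ⟨x, rfl⟩ := exists_eq_eval_of_extreme hm
      exact hXQ x.2
    · exact hQc.linear_preimage (barycenter X).toLinearMap
  rw [closure_convexHull_extremePoints (s := functionStates X) isCompact_stateSet
    convex_stateSet] at hsub
  exact hsub hl

/-- The only state whose barycenter is an extreme point `q` is the evaluation at `q`. -/
theorem eq_eval_of_barycenter_extreme [CompactSpace X] (hQ : IsClosed Q) (hQc : Convex ℝ Q)
    (hXQ : X ⊆ Q) {q : I → ℂ} (hq : q ∈ Q.extremePoints ℝ) {l : C(X, ℂ) → ℂ}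
    (hl : l ∈ functionStates X) (hlq : barycenter X l = q) :
    ∃ x : X, (x : I → ℂ) = q ∧ l = fun f => f x := by
  set F : Set (C(X, ℂ) → ℂ) := {m ∈ functionStates X | barycenter X m = q} with hF
  have hFc : IsCompact F :=
    isCompact_stateSet.inter_right (isClosed_singleton.preimage (barycenter X).continuous)
  have hFconv : Convex ℝ F :=
    convex_stateSet.inter ((convex_singleton q).linear_preimage (barycenter X).toLinearMap)
  have hext : ∀ m ∈ F.extremePoints ℝ, ∃ x : X, (x : I → ℂ) = q ∧ m = fun f => f x := by
    intro m hm
    -- The fibre over an extreme point is a face, so its extreme points are extreme states, hence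
    -- evaluations. Only the evaluation at `q` itself has barycenter `q`, and Krein-Milman reduces
    -- the fibre to that one state.
    have : IsExtreme ℝ (functionStates X) F := by
      refine ⟨fun m hm => hm.1, fun a ha b hb c hc hcab => ?_⟩
      have h1 := barycenter_mem hQ hQc hXQ ha
      have h2 := barycenter_mem hQ hQc hXQ hb
      obtain ⟨s, t, hs, ht, hst, rfl⟩ := hcab
      refine ⟨ha, (hq.2 h1 h2 ⟨s, t, hs, ht, hst, ?_⟩)⟩
      rw [← hc.2, map_add, map_smul, map_smul]
    obtain ⟨x, rfl⟩ := exists_eq_eval_of_extreme (this.extremePoints_subset_extremePoints hm)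
    exact ⟨x, hm.1.2, rfl⟩
  obtain ⟨m, hm⟩ := hFc.extremePoints_nonempty ⟨l, hl, hlq⟩
  obtain ⟨x, hxq, rfl⟩ := hext m hm
  refine ⟨x, hxq, ?_⟩
  have hsub : closure (convexHull ℝ (F.extremePoints ℝ)) ⊆ {fun f => f x} := by
    refine closure_minimal (convexHull_min ?_ (convex_singleton _)) isClosed_singleton
    intro m hm
    obtain ⟨y, hyq, rfl⟩ := hext m hm
    have : y = x := Subtype.ext (hyq.trans hxq.symm)
    rw [this]
    rfl
  rw [closure_convexHull_extremePoints hFc hFconv] at hsub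
  exact hsub ⟨hl, hlq⟩

/-- Milman's converse to the Krein-Milman theorem. -/
theorem mem_of_mem_closedConvexHull_of_extreme (hX : IsCompact X) (hQ : IsClosed Q)
    (hQc : Convex ℝ Q) (hXQ : X ⊆ Q) {q : I → ℂ} (hq : q ∈ Q.extremePoints ℝ)
    (hqX : q ∈ closure (convexHull ℝ X)) : q ∈ X := by
  have : CompactSpace X := isCompact_iff_compactSpace.1 hX
  -- The barycenters of states form a compact convex set containing `X`, so every point of the
  -- closed hull is one.
  have himg : closure (convexHull ℝ X) ⊆ barycenter X '' functionStates X := by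
    refine closure_minimal (convexHull_min ?_ ?_) ?_
    · intro x hx
      exact ⟨_, eval_mem_functionStates (⟨x, hx⟩ : X), rfl⟩
    · exact convex_stateSet.linear_image (barycenter X).toLinearMap
    · exact (isCompact_stateSet.image (barycenter X).continuous).isClosed
  obtain ⟨l, hl, hlq⟩ := himg hqX
  obtain ⟨x, rfl, -⟩ := eq_eval_of_barycenter_extreme hQ hQc hXQ hq hl hlq
  exact x.2

end Barycenter

/-! ### States and regular Borel probability measures -/

section Measures

open MeasureTheory Filter Topology

variable {X : Type*} [TopologicalSpace X]

theorem integrable_continuousMap [CompactSpace X] [MeasurableSpace X] [BorelSpace X]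
    (μ : ProbabilityMeasure X) (f : C(X, ℂ)) : Integrable f (μ : Measure X) :=
  (BoundedContinuousFunction.mkOfCompact f).integrable _

/-- Integration of continuous functions against a probability measure. -/
noncomputable def integralState [MeasurableSpace X] (μ : ProbabilityMeasure X) :
    C(X, ℂ) → ℂ := fun f => ∫ x, f x ∂(μ : Measure X)

theorem integralState_mem [CompactSpace X] [MeasurableSpace X] [BorelSpace X]
    (μ : ProbabilityMeasure X) :
    integralState μ ∈ functionStates X := by
  let L : C(X, ℂ) →ₗ[ℂ] ℂ :=
    { toFun := integralState μ
      map_add' := fun f g => integral_add (integrable_continuousMap μ f)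
        (integrable_continuousMap μ g)
      map_smul' := fun c f => integral_smul c f }
  refine mem_functionStates L ?_ fun f hf => ?_
  · change ∫ _, (1 : ℂ) ∂(μ : Measure X) = 1
    simp
  · exact integral_nonneg fun x => hf x

theorem integralState_dirac [MeasurableSpace X] [BorelSpace X] (x : X) :
    integralState (diracProba x) = fun f => f x := by
  funext f
  exact integral_dirac' (fun y => f y) x f.continuous.measurable.stronglyMeasurable

theorem tendsto_iff_integralState [CompactSpace X] [MeasurableSpace X] [BorelSpace X]
    {γ : Type*} {F : Filter γ} {μs : γ → ProbabilityMeasure X} {μ : ProbabilityMeasure X} :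
    Tendsto μs F (𝓝 μ) ↔ Tendsto (fun i => integralState (μs i)) F (𝓝 (integralState μ)) := by
  rw [ProbabilityMeasure.tendsto_iff_forall_integral_rclike_tendsto ℂ, tendsto_pi_nhds]
  constructor
  · intro h f
    exact h (BoundedContinuousFunction.mkOfCompact f)
  · intro h f
    exact h f.toContinuousMap

/-- Every state of `C(X)` is integration against a regular Borel probability measure. -/
theorem exists_measure_of_state [CompactSpace X] [T2Space X] [MeasurableSpace X] [BorelSpace X]
    {l : C(X, ℂ) → ℂ} (hl : l ∈ functionStates X) :
    ∃ μ : ProbabilityMeasure X, (μ : Measure X).Regular ∧ integralState μ = l := by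
  let L := stateSet.toLinearMap hl
  have hL1 : L 1 = 1 := hl.2.2.1
  have hLpos : ∀ f : C(X, ℂ), 0 ≤ f → 0 ≤ L f := hl.2.2.2.1
  let cx : CompactlySupportedContinuousMap X ℝ → C(X, ℂ) := fun f =>
    ⟨fun x => (f x : ℂ), Complex.continuous_ofReal.comp f.continuous⟩
  let Λ : CompactlySupportedContinuousMap X ℝ →ₚ[ℝ] ℝ := PositiveLinearMap.mk₀
    { toFun := fun f => (L (cx f)).re
      map_add' := fun f g => by
        have : cx (f + g) = cx f + cx g := by ext x; simp [cx]
        rw [this, map_add, Complex.add_re]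
      map_smul' := fun c f => by
        have : cx (c • f) = (c : ℂ) • cx f := by ext x; simp [cx]
        rw [this, map_smul]
        simp }
    (fun f hf => by
      have : 0 ≤ L (cx f) := hLpos _ fun x => by
        have : 0 ≤ f x := hf x
        change (0 : ℂ) ≤ (f x : ℂ)
        exact_mod_cast this
      exact (Complex.le_def.1 this).1)
  have hΛ : ∀ f, Λ f = (L (cx f)).re := fun f => rfl
  let cc : C(X, ℝ) → CompactlySupportedContinuousMap X ℝ := fun f =>
    ⟨f, HasCompactSupport.of_compactSpace _⟩
  have hreal : ∀ f : C(X, ℝ), L (cx (cc f)) = ((Λ (cc f) : ℝ) : ℂ) := by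
    intro f
    apply Complex.ext
    · rfl
    -- `f + ‖f‖` is nonnegative, so `L` is real on it and therefore on `f`.
    · have h0 : 0 ≤ L (cx (cc f) + (‖f‖ : ℂ) • 1) := hLpos _ fun x => by
        change (0 : ℂ) ≤ (f x : ℂ) + (‖f‖ : ℂ) * 1
        have : 0 ≤ f x + ‖f‖ := by linarith [(abs_le.1 (f.norm_coe_le_norm x)).1]
        rw [mul_one]
        exact_mod_cast this
      rw [map_add, map_smul, hL1] at h0
      have := (Complex.le_def.1 h0).2
      simpa using this.symm
  let μ := RealRMK.rieszMeasure Λ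
  have hint : ∀ f : C(X, ℝ), ∫ x, f x ∂μ = Λ (cc f) := fun f =>
    RealRMK.integral_rieszMeasure Λ (cc f)
  have hprob : IsProbabilityMeasure μ := by
    refine ⟨?_⟩
    have h1 := hint 1
    have h2 : cx (cc 1) = 1 := by ext x; simp [cx, cc]
    rw [hΛ, h2, hL1] at h1
    simp only [ContinuousMap.one_apply, integral_const, smul_eq_mul, mul_one,
      Complex.one_re, Measure.real] at h1
    exact (ENNReal.toReal_eq_one_iff _).1 h1
  refine ⟨⟨μ, hprob⟩, inferInstanceAs (RealRMK.rieszMeasure Λ).Regular, ?_⟩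
  funext f
  let fr : C(X, ℝ) := ⟨fun x => (f x).re, Complex.continuous_re.comp f.continuous⟩
  let fi : C(X, ℝ) := ⟨fun x => (f x).im, Complex.continuous_im.comp f.continuous⟩
  have hf : f = cx (cc fr) + Complex.I • cx (cc fi) := by
    ext x
    simp only [cx, cc, fr, fi, ContinuousMap.add_apply, ContinuousMap.smul_apply,
      ContinuousMap.coe_mk, CompactlySupportedContinuousMap.coe_mk, smul_eq_mul]
    rw [mul_comm]
    exact (Complex.re_add_im _).symm
  have h1 : L f = ((Λ (cc fr) : ℝ) : ℂ) + Complex.I * ((Λ (cc fi) : ℝ) : ℂ) := by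
    conv_lhs => rw [hf]
    rw [map_add, map_smul, hreal, hreal, smul_eq_mul]
  change ∫ x, f x ∂μ = L f
  rw [h1, ← hint, ← hint]
  have hfi : Integrable f μ := (BoundedContinuousFunction.mkOfCompact f).integrable _
  rw [← integral_re_add_im hfi]
  simp only [RCLike.re_to_complex, RCLike.im_to_complex, RCLike.I_to_complex]
  rw [mul_comm Complex.I]
  rfl

variable {G : Type*} [Group G] [MulAction G X] [ContinuousConstSMul G X]

theorem integralState_map [MeasurableSpace X] [BorelSpace X] (μ : ProbabilityMeasure X) (s : G) :
    integralState (μ.map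
      ((continuous_const_smul s : Continuous fun y : X => s • y).measurable.aemeasurable)) =
      fun f => integralState μ (translateFun s⁻¹ f) := by
  funext f
  change ∫ x, f x ∂(Measure.map (fun y : X => s • y) (μ : Measure X)) = _
  rw [integral_map (continuous_const_smul s).measurable.aemeasurable
    f.continuous.measurable.aestronglyMeasurable]
  simp [integralState, translateFun]

/-- This and `isStronglyProximal_of_states` translate strong proximality from measures to states.
The inverse appears because `(s ν)(f) = ν (s⁻¹ f)`. -/
theorem IsStronglyProximal.exists_eval_mem_closure [CompactSpace X] [T2Space X]
    (h : IsStronglyProximal G X) {l : C(X, ℂ) → ℂ} (hl : l ∈ functionStates X) :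
    ∃ x : X, (fun f : C(X, ℂ) => f x) ∈
      closure (Set.range fun (s : G) (f : C(X, ℂ)) => l (translateFun s⁻¹ f)) := by
  let : MeasurableSpace X := borel X
  have : BorelSpace X := ⟨rfl⟩
  obtain ⟨μ, hμ, rfl⟩ := exists_measure_of_state hl
  obtain ⟨x, hx⟩ := h μ hμ
  refine ⟨x, ?_⟩
  have hcont : Continuous (integralState : ProbabilityMeasure X → C(X, ℂ) → ℂ) :=
    continuous_iff_continuousAt.2 fun μ => tendsto_iff_integralState.1 tendsto_id
  have := image_closure_subset_closure_image hcont (Set.mem_image_of_mem _ hx)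
  rw [integralState_dirac, ← Set.range_comp] at this
  refine closure_mono (le_of_eq ?_) this
  congr 1
  funext s
  exact integralState_map μ s

theorem isStronglyProximal_of_states [CompactSpace X]
    (h : ∀ l ∈ functionStates X, ∃ x : X,
    (fun f : C(X, ℂ) => f x) ∈
      closure (Set.range fun (s : G) (f : C(X, ℂ)) => l (translateFun s⁻¹ f))) :
    IsStronglyProximal G X := by
  let : MeasurableSpace X := borel X
  have : BorelSpace X := ⟨rfl⟩
  intro μ _
  obtain ⟨x, hx⟩ := h _ (integralState_mem μ)
  refine ⟨x, ?_⟩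
  -- Pulling the neighbourhood filter of the evaluation back to `G` gives a filter along which the
  -- translated measures converge, as convergence can be tested on states.
  have hne : (comap (fun (s : G) (f : C(X, ℂ)) => integralState μ (translateFun s⁻¹ f))
      (𝓝 fun f => f x)).NeBot := by
    refine comap_neBot fun t ht => ?_
    obtain ⟨_, hy, s, rfl⟩ := mem_closure_iff_nhds.1 hx t ht
    exact ⟨s, hy⟩
  refine mem_closure_of_tendsto (b := comap (fun (s : G) (f : C(X, ℂ)) =>
    integralState μ (translateFun s⁻¹ f)) (𝓝 fun f => f x)) (f := fun s : G => μ.map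
      ((continuous_const_smul s : Continuous fun y : X => s • y).measurable.aemeasurable)) ?_
    (Eventually.of_forall fun s => Set.mem_range_self s)
  rw [tendsto_iff_integralState, integralState_dirac]
  simp only [integralState_map]
  exact tendsto_comap

end Measures

/-! ### Boundaries in compact convex sets -/

-- Compact convex `G`-spaces are modelled as sets of functions on a `G`-set, with `(s • l) i = l
-- (s⁻¹ • i)`. State spaces and their products have this form.
attribute [local instance] arrowAction

section ArrowAction

variable {G : Type*} [Group G] {I : Type*} [MulAction G I]

instance arrow_continuousConstSMul : ContinuousConstSMul G (I → ℂ) :=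
  ⟨fun s => continuous_pi fun i => continuous_apply (s⁻¹ • i)⟩

instance SubMulAction.continuousConstSMul {Y : Type*} [TopologicalSpace Y] [MulAction G Y]
    [ContinuousConstSMul G Y] (X : SubMulAction G Y) : ContinuousConstSMul G X :=
  ⟨fun s => ((continuous_const_smul s).comp continuous_subtype_val).subtype_mk _⟩

/-- The action of a group element on functions, as a continuous linear map. -/
def arrowCLM (s : G) : (I → ℂ) →L[ℝ] (I → ℂ) where
  toFun l := s • l
  map_add' _ _ := rfl
  map_smul' _ _ := rfl
  cont := continuous_const_smul s

/-- The closed convex hull of an orbit is invariant. -/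
theorem smul_mem_closure_convexHull_orbit (x : I → ℂ) (s : G) {y : I → ℂ}
    (hy : y ∈ closure (convexHull ℝ (MulAction.orbit G x))) :
    s • y ∈ closure (convexHull ℝ (MulAction.orbit G x)) := by
  have : closure (convexHull ℝ (MulAction.orbit G x)) ⊆
      arrowCLM s ⁻¹' closure (convexHull ℝ (MulAction.orbit G x)) := by
    refine closure_minimal (convexHull_min ?_ ?_)
      (isClosed_closure.preimage (arrowCLM s).continuous)
    · intro z hz
      exact subset_closure (subset_convexHull _ _ (MulAction.mem_orbit_of_mem_orbit s hz))
    · exact (convex_convexHull _ _).closure.linear_preimage (arrowCLM s).toLinearMap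
  exact this hy

/-- The nonempty compact convex invariant sets of functions. -/
def IsConvexGSet (G : Type*) [Group G] {I : Type*} [MulAction G I] (K : Set (I → ℂ)) : Prop :=
  K.Nonempty ∧ IsCompact K ∧ Convex ℝ K ∧ ∀ (s : G), ∀ x ∈ K, s • x ∈ K

theorem IsConvexGSet.exists_minimal {K : Set (I → ℂ)} (hK : IsConvexGSet G K) :
    ∃ Q ⊆ K, IsConvexGSet G Q ∧ ∀ R ⊆ Q, IsConvexGSet G R → R = Q := by
  obtain ⟨Q, hQK, hQ⟩ := zorn_superset_nonempty {Q | IsConvexGSet G Q} (by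
    intro c hc hchain hne
    refine ⟨⋂₀ c, ⟨?_, ?_, ?_, ?_⟩, fun s hs => Set.sInter_subset_of_mem hs⟩
    · have : Nonempty c := hne.to_subtype
      rw [Set.sInter_eq_iInter]
      refine IsCompact.nonempty_iInter_of_directed_nonempty_isCompact_isClosed _ (fun t u => ?_)
        (fun t => (hc t.2).1) (fun t => (hc t.2).2.1) fun t => (hc t.2).2.1.isClosed
      obtain htu | hut := hchain.total t.2 u.2
      exacts [⟨t, Set.Subset.rfl, htu⟩, ⟨u, hut, Set.Subset.rfl⟩]
    · obtain ⟨t, ht⟩ := hne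
      exact (hc ht).2.1.of_isClosed_subset
        (isClosed_sInter fun u hu => (hc hu).2.1.isClosed) (Set.sInter_subset_of_mem ht)
    · exact convex_sInter fun t ht => (hc ht).2.2.1
    · intro s x hx t ht
      exact (hc ht).2.2.2 s x (hx t ht)) K hK
  exact ⟨Q, hQK, hQ.prop, fun R hRQ hR => hRQ.antisymm (hQ.2 hR hRQ)⟩

/-- In a minimal compact convex invariant set, every orbit has every extreme point in its
closure. -/
theorem extreme_mem_closure_orbit {Q : Set (I → ℂ)} (hQ : IsConvexGSet G Q)
    (hmin : ∀ R ⊆ Q, IsConvexGSet G R → R = Q) {q : I → ℂ} (hq : q ∈ Q.extremePoints ℝ)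
    {x : I → ℂ} (hx : x ∈ Q) : q ∈ closure (MulAction.orbit G x) := by
  have hQcl := hQ.2.1.isClosed
  have horb : MulAction.orbit G x ⊆ Q := by
    rintro _ ⟨s, rfl⟩
    exact hQ.2.2.2 s x hx
  have hsub : closure (convexHull ℝ (MulAction.orbit G x)) ⊆ Q :=
    closure_minimal (convexHull_min horb hQ.2.2.1) hQcl
  -- By minimality the closed convex hull of the orbit is all of `Q`, so Milman's converse places
  -- `q` in the orbit closure.
  have heq := hmin _ hsub ⟨⟨x, subset_closure (subset_convexHull _ _ (MulAction.mem_orbit_self x))⟩,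
    hQ.2.1.of_isClosed_subset isClosed_closure hsub, (convex_convexHull _ _).closure,
    fun s y hy => smul_mem_closure_convexHull_orbit x s hy⟩
  have hcsub : closure (MulAction.orbit G x) ⊆ Q := closure_minimal horb hQcl
  refine mem_of_mem_closedConvexHull_of_extreme
    (hQ.2.1.of_isClosed_subset isClosed_closure hcsub) hQcl hQ.2.2.1 hcsub hq ?_
  exact closure_mono (convexHull_mono subset_closure) (heq ▸ hq.1)

end ArrowAction

section Translate

variable {G : Type*} [Group G] {X : Type*} [TopologicalSpace X] [MulAction G X]
  [ContinuousConstSMul G X]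

/-- The action of `G` on `C(X)` by translations. -/
noncomputable abbrev translateAction : MulAction G C(X, ℂ) where
  smul := translateFun
  one_smul f := by
    ext x
    change f ((1 : G)⁻¹ • x) = f x
    rw [inv_one, one_smul]
  mul_smul s t f := by
    ext x
    change f ((s * t)⁻¹ • x) = f (t⁻¹ • s⁻¹ • x)
    rw [mul_inv_rev, mul_smul]

attribute [local instance] translateAction

theorem smul_mem_functionStates [CompactSpace X] (s : G) {l : C(X, ℂ) → ℂ}
    (hl : l ∈ functionStates X) : s • l ∈ functionStates X := by
  let T : C(X, ℂ) →ₗ[ℂ] C(X, ℂ) :=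
    { toFun := fun f => s⁻¹ • f
      map_add' := fun _ _ => rfl
      map_smul' := fun _ _ => rfl }
  exact mem_functionStates (stateSet.toLinearMap hl ∘ₗ T) hl.2.2.1
    fun f hf => hl.2.2.2.1 _ fun x => hf (s⁻¹⁻¹ • x)

theorem smul_eval (s : G) (x : X) :
    s • (fun f : C(X, ℂ) => f x) = fun f : C(X, ℂ) => f (s • x) := by
  funext f
  change f (s⁻¹⁻¹ • x) = f (s • x)
  rw [inv_inv]

end Translate

/-! ### Boundaries as orbit closures of extreme points -/

section Glasner

attribute [local instance] translateAction

variable {G : Type*} [Group G] {I : Type*} [MulAction G I]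

/-- Every compact convex `G`-space of functions contains a `G`-boundary. -/
theorem IsConvexGSet.exists_boundary {K : Set (I → ℂ)} (hK : IsConvexGSet G K) :
    ∃ X : SubMulAction G (I → ℂ), (X : Set (I → ℂ)) ⊆ K ∧ IsGBoundary G X := by
  obtain ⟨Q, hQK, hQ, hmin⟩ := hK.exists_minimal
  obtain ⟨q, hq⟩ := hQ.2.1.extremePoints_nonempty hQ.1
  have hQcl := hQ.2.1.isClosed
  let X : SubMulAction G (I → ℂ) :=
    { carrier := closure (MulAction.orbit G q)
      smul_mem' := fun s x hx => smul_closure_orbit_subset s q (Set.smul_mem_smul_set hx) }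
  have hXQ : (X : Set (I → ℂ)) ⊆ Q := by
    refine closure_minimal ?_ hQcl
    rintro _ ⟨s, rfl⟩
    exact hQ.2.2.2 s q hq.1
  have hXcl : IsClosed (X : Set (I → ℂ)) := isClosed_closure
  have hXc : CompactSpace X :=
    isCompact_iff_compactSpace.1 (hQ.2.1.of_isClosed_subset hXcl hXQ)
  have hqX : q ∈ X := subset_closure (MulAction.mem_orbit_self q)
  -- Every orbit closure contains `q`, hence the whole orbit closure `X` of `q`. This is minimality.
  have hmem : ∀ x : X, (X : Set (I → ℂ)) ⊆ closure (MulAction.orbit G (x : I → ℂ)) := by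
    intro x
    refine closure_minimal ?_ isClosed_closure
    rintro _ ⟨s, rfl⟩
    exact smul_closure_orbit_subset s (x : I → ℂ)
      (Set.smul_mem_smul_set (extreme_mem_closure_orbit hQ hmin hq (hXQ x.2)))
  refine ⟨X, hXQ.trans hQK, ⟨⟨q, hqX⟩, hXc, inferInstance, ⟨fun x => ?_⟩, ?_⟩⟩
  · intro y
    rw [Topology.IsInducing.subtypeVal.closure_eq_preimage_closure_image]
    refine closure_mono ?_ (hmem x y.2)
    rintro _ ⟨s, rfl⟩
    exact ⟨s • x, ⟨s, rfl⟩, rfl⟩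
  · refine isStronglyProximal_of_states fun l hl => ⟨⟨q, hqX⟩, ?_⟩
    change (fun f : C(X, ℂ) => f ⟨q, hqX⟩) ∈ closure (MulAction.orbit G l)
    have horb : MulAction.orbit G l ⊆ functionStates X := by
      rintro _ ⟨s, rfl⟩
      exact smul_mem_functionStates s hl
    let b : (C(X, ℂ) → ℂ) →L[ℝ] (I → ℂ) := barycenter (X : Set (I → ℂ))
    let c : I → C(X, ℂ) := coordFun (X : Set (I → ℂ))
    have hbar : ∀ m ∈ functionStates X, b m ∈ Q := fun m hm =>
      barycenter_mem hQcl hQ.2.2.1 hXQ hm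
    have hequiv : ∀ (s : G) (m : C(X, ℂ) → ℂ),
        b (s • m) = s • b m := by
      intro s m
      funext i
      change m (s⁻¹ • c i) = m (c (s⁻¹ • i))
      congr 1
      ext x
      change (x : I → ℂ) (s⁻¹⁻¹⁻¹ • i) = (x : I → ℂ) (s⁻¹ • i)
      rw [inv_inv]
    let D : Set (C(X, ℂ) → ℂ) := closure (convexHull ℝ (MulAction.orbit G l))
    have hDs : D ⊆ functionStates X :=
      closure_minimal (convexHull_min horb convex_stateSet) isClosed_stateSet
    have hDc : IsCompact D := isCompact_stateSet.of_isClosed_subset isClosed_closure hDs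
    -- The barycenter map is affine and equivariant, so the image of the closed convex hull `D` of
    -- the orbit of `l` is an invariant convex set; minimality of `Q` makes it everything. So some
    -- state in `D` lies over `q`, and it must be the evaluation at `q`.
    have himg : b '' D = Q := by
      refine hmin _ ?_ ⟨⟨_, Set.mem_image_of_mem _ (subset_closure (subset_convexHull _ _
        (MulAction.mem_orbit_self l)))⟩, hDc.image b.continuous,
        (convex_convexHull _ _).closure.linear_image b.toLinearMap, ?_⟩
      · rintro _ ⟨m, hm, rfl⟩
        exact hbar m (hDs hm)
      · rintro s _ ⟨m, hm, rfl⟩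
        exact ⟨s • m, smul_mem_closure_convexHull_orbit l s hm, hequiv s m⟩
    have huniq : ∀ m ∈ D, b m = q →
        m = fun f : C(X, ℂ) => f ⟨q, hqX⟩ := by
      intro m hm hmq
      obtain ⟨x, hx, h⟩ := eq_eval_of_barycenter_extreme hQcl hQ.2.2.1 hXQ hq (hDs hm) hmq
      have hxq : x = ⟨q, hqX⟩ := Subtype.ext hx
      rwa [hxq] at h
    obtain ⟨m, hm, hmq⟩ : q ∈ b '' D := himg ▸ hq.1
    have hmD : (fun f : C(X, ℂ) => f ⟨q, hqX⟩) ∈ D := huniq m hm hmq ▸ hm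
    -- Being the only point of `D` over an extreme point, the evaluation is extreme in `D`. Milman's
    -- converse moves it from the closed hull to the orbit closure.
    have hext : (fun f : C(X, ℂ) => f ⟨q, hqX⟩) ∈ D.extremePoints ℝ := by
      refine ⟨hmD, fun m₁ h₁ m₂ h₂ hm => ?_⟩
      refine huniq m₁ h₁ (hq.2 (hbar m₁ (hDs h₁)) (hbar m₂ (hDs h₂)) ?_)
      obtain ⟨s, t, hs, ht, hst, h⟩ := hm
      refine ⟨s, t, hs, ht, hst, ?_⟩
      rw [← map_smul, ← map_smul, ← map_add, h]
      rfl
    have hcD : closure (MulAction.orbit G l) ⊆ D := closure_mono (subset_convexHull _ _)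
    exact mem_of_mem_closedConvexHull_of_extreme
      (hDc.of_isClosed_subset isClosed_closure hcD) isClosed_closure
      (convex_convexHull _ _).closure hcD hext
      (closure_mono (convexHull_mono subset_closure) hmD)

end Glasner

/-! ### Rigidity of boundaries -/

section Rigidity

attribute [local instance] translateAction

variable {G : Type*} [Group G] {X : Type*} [TopologicalSpace X] [MulAction G X]
  [ContinuousConstSMul G X]

theorem continuous_evalFun : Continuous fun (x : X) (f : C(X, ℂ)) => f x :=
  continuous_pi fun f => f.continuous

theorem injective_evalFun [CompactSpace X] [T2Space X] :
    Function.Injective fun (x : X) (f : C(X, ℂ)) => f x := by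
  intro x y h
  refine (WeakDual.CharacterSpace.continuousMapEval_bijective X ℂ).1 ?_
  refine Subtype.ext (ContinuousLinearMap.ext fun f => ?_)
  exact congrFun h f

/-- An equivariant continuous map from a minimal compact `G`-space to the states of `C(X)`, for a
boundary `X`, consists of point evaluations. -/
theorem IsGBoundary.exists_map_of_states (hX : IsGBoundary G X) [CompactSpace X] {M : Type*}
    [TopologicalSpace M] [CompactSpace M] [Nonempty M] [MulAction G M] [MulAction.IsMinimal G M]
    {Φ : M → C(X, ℂ) → ℂ} (hΦc : Continuous Φ) (hΦ : ∀ m, Φ m ∈ functionStates X)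
    (hΦG : ∀ (s : G) (m : M), Φ (s • m) = s • Φ m) :
    ∃ p : M → X, Continuous p ∧ Function.Surjective p ∧ (∀ (s : G) (m : M), p (s • m) = s • p m) ∧
      ∀ m, Φ m = fun f => f (p m) := by
  have := hX.t2
  have := hX.minimal
  set E : X → C(X, ℂ) → ℂ := fun x f => f x with hE
  have hEc : Continuous E := continuous_evalFun
  have hEi : Function.Injective E := injective_evalFun
  have hEemb : Topology.IsClosedEmbedding E := hEc.isClosedEmbedding hEi
  have hΦcl : IsClosed (Set.range Φ) := (isCompact_range hΦc).isClosed
  have hEs : ∀ (s : G) (x : X), E (s • x) = s • E x := fun s x => (smul_eval s x).symm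
  obtain ⟨m₀⟩ := ‹Nonempty M›
  obtain ⟨x, hx⟩ := hX.stronglyProximal.exists_eval_mem_closure (hΦ m₀)
  obtain ⟨m₁, hm₁⟩ : E x ∈ Set.range Φ := by
    refine closure_minimal ?_ hΦcl hx
    rintro _ ⟨s, rfl⟩
    exact ⟨s • m₀, hΦG s m₀⟩
  -- The orbit of `m₁` is dense and is sent to evaluations, which form a closed set.
  have hmem : ∀ m, Φ m ∈ Set.range E := by
    intro m
    have h1 : Φ m ∈ closure (Φ '' MulAction.orbit G m₁) :=
      image_closure_subset_closure_image hΦc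
        (Set.mem_image_of_mem _ (MulAction.dense_orbit G m₁ m))
    refine closure_minimal ?_ hEemb.isClosed_range h1
    rintro _ ⟨_, ⟨s, rfl⟩, rfl⟩
    exact ⟨s • x, by rw [hEs, ← hm₁]; exact (hΦG s m₁).symm⟩
  choose p hp using hmem
  refine ⟨p, ?_, fun y => ?_, fun s m => hEi ?_, fun m => (hp m).symm⟩
  · rw [hEemb.isInducing.continuous_iff]
    convert hΦc using 1
    exact funext hp
  · have h1 : E y ∈ closure (E '' MulAction.orbit G x) :=
      image_closure_subset_closure_image hEc
        (Set.mem_image_of_mem _ (MulAction.dense_orbit G x y))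
    obtain ⟨m, hm⟩ : E y ∈ Set.range Φ := by
      refine closure_minimal ?_ hΦcl h1
      rintro _ ⟨_, ⟨s, rfl⟩, rfl⟩
      exact ⟨s • m₁, by rw [hΦG, hm₁]; exact (hEs s x).symm⟩
    exact ⟨m, hEi ((hp m).trans hm)⟩
  · rw [hp, hΦG, hEs, hp]

variable {M : Type*} [TopologicalSpace M] [CompactSpace M] [Nonempty M] [MulAction G M]
  [ContinuousConstSMul G M] [MulAction.IsMinimal G M]

/-- The family of states `f ↦ φ f m` is equivariant in `m`, so rigidity makes each of them an
evaluation and `φ` a composition. -/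
theorem IsGBoundary.exists_map (hX : IsGBoundary G X) [CompactSpace X]
    {φ : C(X, ℂ) →ₗ[ℂ] C(M, ℂ)} (hφ : IsUnitalPositiveEquivariant G φ) :
    ∃ p : M → X, Continuous p ∧ Function.Surjective p ∧ ∀ f m, φ f m = f (p m) := by
  obtain ⟨p, hpc, hps, -, hp⟩ := hX.exists_map_of_states (G := G) (Φ := fun m f => φ f m)
    (continuous_pi fun f => (φ f).continuous) (fun m => by
      let L : C(X, ℂ) →ₗ[ℂ] ℂ := (ContinuousMap.evalAlgHom ℂ ℂ m).toLinearMap ∘ₗ φ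
      refine mem_functionStates L ?_ fun f hf => hφ.map_nonneg f hf m
      change φ 1 m = 1
      rw [hφ.map_one]
      rfl) (fun s m => by
      funext f
      change φ f (s • m) = φ (translateFun s⁻¹ f) m
      rw [hφ.equivariant]
      simp [translateFun])
  exact ⟨p, hpc, hps, fun f m => congrFun (hp m) f⟩

theorem IsGBoundary.isInjectiveStarHom (hX : IsGBoundary G X) [CompactSpace X]
    {φ : C(X, ℂ) →ₗ[ℂ] C(M, ℂ)} (hφ : IsUnitalPositiveEquivariant G φ) :
    IsInjectiveStarHom φ := by
  obtain ⟨p, hpc, hps, hp⟩ := hX.exists_map hφ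
  refine ⟨fun f g hfg => ?_, ContinuousMap.compStarAlgHom' ℂ ℂ ⟨p, hpc⟩, fun f => ?_⟩
  · ext x
    obtain ⟨m, rfl⟩ := hps x
    rw [← hp, ← hp, hfg]
  · ext m
    exact (hp f m).symm

/-- The average of `φ` and `ψ` is also a composition, hence multiplicative. Comparing its values on
`f` and `f * f` gives `(f (p m) - f (q m))² = 0`. -/
theorem IsGBoundary.unique_map (hX : IsGBoundary G X) [CompactSpace X]
    {φ ψ : C(X, ℂ) →ₗ[ℂ] C(M, ℂ)} (hφ : IsUnitalPositiveEquivariant G φ)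
    (hψ : IsUnitalPositiveEquivariant G ψ) : φ = ψ := by
  have h2 : (0 : ℂ) ≤ (1 / 2 : ℂ) := by
    simp
  have hχ : IsUnitalPositiveEquivariant G ((1 / 2 : ℂ) • (φ + ψ)) := by
    refine ⟨?_, fun f hf m => ?_, fun s f => ?_⟩
    · ext m
      simp only [LinearMap.smul_apply, LinearMap.add_apply, hφ.map_one, hψ.map_one,
        ContinuousMap.smul_apply, ContinuousMap.add_apply, ContinuousMap.one_apply, smul_eq_mul]
      norm_num
    · exact mul_nonneg h2 (add_nonneg (hφ.map_nonneg f hf m) (hψ.map_nonneg f hf m))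
    · rw [LinearMap.smul_apply, LinearMap.add_apply, hφ.equivariant, hψ.equivariant]
      rfl
  obtain ⟨p, -, -, hp⟩ := hX.exists_map hφ
  obtain ⟨q, -, -, hq⟩ := hX.exists_map hψ
  obtain ⟨r, -, -, hr⟩ := hX.exists_map hχ
  ext f m
  have key : ∀ f : C(X, ℂ), (1 / 2 : ℂ) * (f (p m) + f (q m)) = f (r m) := by
    intro f
    rw [← hr, ← hp, ← hq]
    rfl
  have h1 := key f
  have h3 := key (f * f)
  simp only [ContinuousMap.mul_apply] at h3
  rw [← h1] at h3
  rw [hp, hq]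
  have h4 : (f (p m) - f (q m)) * (f (p m) - f (q m)) = 0 := by linear_combination 4 * h3
  exact sub_eq_zero.1 (mul_self_eq_zero.1 h4)

end Rigidity

/-! ### Existence of the Furstenberg boundary -/

section Existence

open BoundedContinuousFunction

variable (G : Type u) [Group G] [TopologicalSpace G] [DiscreteTopology G]

/-- The action of a discrete group on its bounded functions by left translations. -/
noncomputable abbrev leftTranslateAction : MulAction G (G →ᵇ ℂ) where
  smul s f := f.compContinuous ⟨fun t => s⁻¹ * t, continuous_of_discreteTopology⟩
  one_smul f := by
    ext t
    change f ((1 : G)⁻¹ * t) = f t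
    simp
  mul_smul s t f := by
    ext r
    change f ((s * t)⁻¹ * r) = f (t⁻¹ * (s⁻¹ * r))
    rw [mul_inv_rev, mul_assoc]

attribute [local instance] leftTranslateAction

/-- For discrete `G` these are the states of all bounded functions on `G`, that is, the probability
measures on its Stone-Čech compactification. Evaluation at the identity is one of them. -/
theorem isConvexGSet_boundedFunctionStates :
    IsConvexGSet G (stateSet (1 : G →ᵇ ℂ) {f | ∀ t, 0 ≤ f t}) := by
  refine ⟨⟨fun f => f 1, fun _ _ => rfl, fun _ _ => rfl, rfl, fun f hf => hf 1,
    fun f => f.norm_coe_le_norm 1⟩, isCompact_stateSet, convex_stateSet, fun s l hl => ?_⟩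
  refine ⟨fun f g => hl.1 (s⁻¹ • f) (s⁻¹ • g), fun c f => hl.2.1 c (s⁻¹ • f), hl.2.2.1, fun f hf =>
    hl.2.2.2.1 _ fun t => hf _, fun f => (hl.2.2.2.2 _).trans ?_⟩
  exact (norm_le (norm_nonneg f)).2 fun t => f.norm_coe_le_norm _

/-- A `G`-boundary in the state space of the algebra of bounded functions on `G`. -/
noncomputable def universalBoundary : SubMulAction G ((G →ᵇ ℂ) → ℂ) :=
  (isConvexGSet_boundedFunctionStates G).exists_boundary.choose

theorem universalBoundary_subset :
    (universalBoundary G : Set ((G →ᵇ ℂ) → ℂ)) ⊆ stateSet (1 : G →ᵇ ℂ) {f | ∀ t, 0 ≤ f t} :=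
  (isConvexGSet_boundedFunctionStates G).exists_boundary.choose_spec.1

theorem isGBoundary_universalBoundary : IsGBoundary G (universalBoundary G) :=
  (isConvexGSet_boundedFunctionStates G).exists_boundary.choose_spec.2

/-- The boundary `universalBoundary G` maps onto every `G`-boundary. -/
theorem universalBoundary_map {B : Type*} [TopologicalSpace B] [MulAction G B]
    [ContinuousConstSMul G B] (hB : IsGBoundary G B) :
    ∃ f : universalBoundary G → B, Continuous f ∧ Function.Surjective f ∧
      ∀ (s : G) (x : universalBoundary G), f (s • x) = s • f x := by
  let : MulAction G C(B, ℂ) := translateAction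
  have hU := isGBoundary_universalBoundary G
  have := hU.compact
  have := hU.nonempty
  have := hU.minimal
  have := hB.compact
  obtain ⟨b⟩ := hB.nonempty
  -- Pullback along the orbit map of `b` turns states of the bounded functions on `G` into states of
  -- `C(B)`, equivariantly.
  let r : C(B, ℂ) → (G →ᵇ ℂ) := fun f => (mkOfCompact f).compContinuous
    ⟨fun t => t • b, continuous_of_discreteTopology⟩
  obtain ⟨p, hpc, hps, hpG, -⟩ := hB.exists_map_of_states (G := G)
    (Φ := fun (x : universalBoundary G) (f : C(B, ℂ)) => (x : (G →ᵇ ℂ) → ℂ) (r f))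
    (continuous_pi fun f => (continuous_apply (r f)).comp continuous_subtype_val)
    (fun x => by
      have hx := universalBoundary_subset G x.2
      exact ⟨fun f g => hx.1 (r f) (r g), fun c f => hx.2.1 c (r f), hx.2.2.1,
        fun f hf => hx.2.2.2.1 (r f) fun t => hf (t • b), fun f => (hx.2.2.2.2 (r f)).trans
          ((norm_le (norm_nonneg f)).2 fun t => f.norm_coe_le_norm _)⟩)
    (fun s x => by
      funext f
      change (x : (G →ᵇ ℂ) → ℂ) (s⁻¹ • r f) = (x : (G →ᵇ ℂ) → ℂ) (r (s⁻¹ • f))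
      refine congrArg (x : (G →ᵇ ℂ) → ℂ) (BoundedContinuousFunction.ext fun t => ?_)
      change f ((s⁻¹⁻¹ * t) • b) = f (s⁻¹⁻¹ • t • b)
      rw [mul_smul])
  exact ⟨p, hpc, hps, hpG⟩

end Existence

/-! ### Universality of the Furstenberg boundary -/

section Furstenberg

/-- Every group has a Furstenberg boundary. -/
theorem exists_furstenbergBoundary (G : Type u) [Group G] :
    ∃ (X : Type u) (_ : TopologicalSpace X) (_ : MulAction G X) (_ : ContinuousConstSMul G X),
      IsFurstenbergBoundary G X := by
  let : TopologicalSpace G := ⊥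
  have : DiscreteTopology G := ⟨rfl⟩
  let : MulAction G (BoundedContinuousFunction G ℂ) := leftTranslateAction G
  exact ⟨universalBoundary G, inferInstance, inferInstance, inferInstance,
    isGBoundary_universalBoundary G, fun B _ _ _ hB => universalBoundary_map G hB⟩

variable {G : Type u} [Group G] {X : Type v} [TopologicalSpace X] [MulAction G X]
  [ContinuousConstSMul G X]

/-- A Furstenberg boundary maps onto the `G`-boundaries in all universes. -/
theorem IsFurstenbergBoundary.exists_map (hX : IsFurstenbergBoundary G X) {B : Type*}
    [TopologicalSpace B] [MulAction G B] [ContinuousConstSMul G B] (hB : IsGBoundary G B) :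
    ∃ f : X → B, Continuous f ∧ Function.Surjective f ∧ ∀ (s : G) (x : X), f (s • x) = s • f x := by
  let : TopologicalSpace G := ⊥
  have : DiscreteTopology G := ⟨rfl⟩
  let : MulAction G (BoundedContinuousFunction G ℂ) := leftTranslateAction G
  -- `universalBoundary G` lives in the universe of `G`, where `hX.universal` applies, and itself
  -- maps onto boundaries in any universe.
  obtain ⟨f, hfc, hfs, hfG⟩ := hX.universal _ (isGBoundary_universalBoundary G)
  obtain ⟨g, hgc, hgs, hgG⟩ := universalBoundary_map G hB
  exact ⟨g ∘ f, hgc.comp hfc, hgs.comp hfs, fun s x => by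
    simp only [Function.comp_apply, hfG, hgG]⟩

/-- A Furstenberg boundary maps equivariantly into every compact convex `G`-space. -/
theorem IsFurstenbergBoundary.exists_map_convex (hX : IsFurstenbergBoundary G X) {I : Type*}
    [MulAction G I] {K : Set (I → ℂ)} (hK : IsConvexGSet G K) :
    ∃ f : X → I → ℂ, Continuous f ∧ (∀ x, f x ∈ K) ∧ ∀ (s : G) (x : X), f (s • x) = s • f x := by
  obtain ⟨Y, hYK, hY⟩ := hK.exists_boundary
  obtain ⟨f, hfc, -, hfG⟩ := hX.exists_map hY
  exact ⟨fun x => f x, continuous_subtype_val.comp hfc, fun x => hYK (f x).2, fun s x => by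
    change (f (s • x) : I → ℂ) = _
    rw [hfG]
    rfl⟩

end Furstenberg

/-! ### Matrices over operator systems and over algebras of functions -/

theorem CStarAlgebra.exists_eq_star_mul_self {D : Type*} [CStarAlgebra D] [PartialOrder D]
    [StarOrderedRing D] {a : D} (ha : 0 ≤ a) : ∃ b, a = star b * b :=
  CStarAlgebra.nonneg_iff_eq_star_mul_self.1 ha

theorem CStarAlgebra.nonneg_of_isUnit_sub {D : Type*} [CStarAlgebra D] [PartialOrder D]
    [StarOrderedRing D] {a : D} (ha : IsSelfAdjoint a)
    (h : ∀ r : ℝ, r < 0 → IsUnit ((r : ℂ) • (1 : D) - a)) : 0 ≤ a := by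
  rw [StarOrderedRing.nonneg_iff_spectrum_nonneg (R := ℝ) a ha]
  intro r hr
  by_contra hlt
  push Not at hlt
  refine hr ?_
  have := h r hlt
  rwa [Complex.coe_smul, ← Algebra.algebraMap_eq_smul_one] at this

theorem CStarAlgebra.norm_le_of_star_mul_self_le {D : Type*} [CStarAlgebra D] [PartialOrder D]
    [StarOrderedRing D] {a : D} {c : ℝ} (hc : 0 ≤ c)
    (h : 0 ≤ ((c ^ 2 : ℝ) : ℂ) • (1 : D) - star a * a) : ‖a‖ ≤ c := by
  rw [sub_nonneg, Complex.coe_smul, ← Algebra.algebraMap_eq_smul_one] at h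
  have h2 := (CStarAlgebra.norm_le_iff_le_algebraMap (star a * a) (sq_nonneg c)
    (star_mul_self_nonneg a)).2 h
  rw [CStarRing.norm_star_mul_self, ← pow_two] at h2
  exact (pow_le_pow_iff_left₀ (norm_nonneg a) hc two_ne_zero).1 h2

open scoped WithCStarModule InnerProductSpace in
/-- A noncommutative convex combination of elements of norm at most `C` has norm at most `C`. -/
theorem CStarAlgebra.norm_sum_conj_le {D : Type*} [CStarAlgebra D] [PartialOrder D]
    [StarOrderedRing D] {κ : Type*} [Fintype κ] (a c : κ → D) (ha : ∀ k, IsSelfAdjoint (a k))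
    (h1 : ∑ k, a k * a k = 1) {C : ℝ} (hC : 0 ≤ C) (hc : ∀ k, ‖c k‖ ≤ C) :
    ‖∑ k, a k * c k * a k‖ ≤ C := by
  -- The sum is the inner product of `(a k)` and `(a k * c k)` in the Hilbert module `D^κ`, so
  -- Cauchy-Schwarz bounds it.
  let x : C⋆ᵐᵒᵈ(D, κ → D) := (WithCStarModule.equiv D (κ → D)).symm a
  let y : C⋆ᵐᵒᵈ(D, κ → D) := (WithCStarModule.equiv D (κ → D)).symm fun k => a k * c k
  have hone : ‖(1 : D)‖ ≤ 1 := by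
    rcases subsingleton_or_nontrivial D with hD | hD
    · simp [Subsingleton.elim (1 : D) 0]
    · simp
  have hx : ‖x‖ ≤ 1 := by
    rw [WithCStarModule.pi_norm, Real.sqrt_le_left zero_le_one, one_pow]
    have : ∑ k, ⟪x k, x k⟫_D = 1 := by
      rw [← h1]
      refine Finset.sum_congr rfl fun k _ => ?_
      change a k * star (a k) = _
      rw [(ha k).star_eq]
    rwa [this]
  have hy : ‖y‖ ≤ C := by
    rw [WithCStarModule.pi_norm, Real.sqrt_le_left hC]
    have h2 : ∑ k, ⟪y k, y k⟫_D ≤ (C ^ 2) • (1 : D) := by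
      rw [← h1, Finset.smul_sum]
      refine Finset.sum_le_sum fun k _ => ?_
      change a k * c k * star (a k * c k) ≤ _
      rw [star_mul, ← mul_assoc, mul_assoc (a k)]
      have h3 : c k * star (c k) ≤ algebraMap ℝ D (C ^ 2) := by
        refine (CStarAlgebra.norm_le_iff_le_algebraMap _ (sq_nonneg C)
          (mul_star_self_nonneg _)).1 ?_
        rw [CStarRing.norm_self_mul_star, ← pow_two]
        exact pow_le_pow_left₀ (norm_nonneg _) (hc k) 2
      have h4 := star_right_conjugate_le_conjugate h3 (a k)
      refine h4.trans (le_of_eq ?_)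
      rw [(ha k).star_eq, Algebra.algebraMap_eq_smul_one, mul_smul_comm, mul_one, smul_mul_assoc]
    have h5 := CStarAlgebra.norm_le_norm_of_nonneg_of_le
      (Finset.sum_nonneg fun k _ => CStarModule.inner_self_nonneg (A := D) (x := y k)) h2
    refine h5.trans ?_
    rw [norm_smul, Real.norm_of_nonneg (sq_nonneg C)]
    nlinarith [sq_nonneg C]
  have hxy : ⟪x, y⟫_D = ∑ k, a k * c k * a k := by
    rw [WithCStarModule.pi_inner]
    refine Finset.sum_congr rfl fun k _ => ?_
    change a k * c k * star (a k) = _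
    rw [(ha k).star_eq]
  rw [← hxy]
  refine (CStarModule.norm_inner_le _).trans ?_
  nlinarith [norm_nonneg x, norm_nonneg y]

namespace CStarMatrix

variable {A : Type*} [CStarAlgebra A] [PartialOrder A] [StarOrderedRing A] {n : ℕ}

/-- Writing `M = N* N` turns the sum into a sum of squares, one for each row of `N`. -/
theorem sum_smul_nonneg {M : CStarMatrix (Fin n) (Fin n) A} (hM : 0 ≤ M) (v : Fin n → ℂ) :
    0 ≤ ∑ i, ∑ j, (star (v i) * v j) • M i j := by
  obtain ⟨N, rfl⟩ := CStarAlgebra.exists_eq_star_mul_self hM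
  have : ∑ i, ∑ j, (star (v i) * v j) • (star N * N) i j =
      ∑ k, star (∑ i, v i • N k i) * ∑ j, v j • N k j := by
    calc _ = ∑ i, ∑ j, ∑ k, (star (v i) * v j) • (star (N k i) * N k j) := by
          simp only [mul_apply, star_apply, Finset.smul_sum]
      _ = ∑ k, ∑ i, ∑ j, (star (v i) * v j) • (star (N k i) * N k j) := by
          rw [Finset.sum_comm]
          refine (Finset.sum_congr rfl fun i _ => Finset.sum_comm).trans ?_
          rw [Finset.sum_comm]
          exact Finset.sum_congr rfl fun k _ => Finset.sum_comm
      _ = _ := by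
          refine Finset.sum_congr rfl fun k _ => ?_
          rw [star_sum, Finset.sum_mul_sum]
          refine Finset.sum_congr rfl fun i _ => Finset.sum_congr rfl fun j _ => ?_
          rw [star_smul, smul_mul_smul_comm]
  rw [this]
  exact Finset.sum_nonneg fun k _ => star_mul_self_nonneg _

/-- A self-adjoint matrix of functions is positive if it is pointwise positive semidefinite. -/
theorem nonneg_of_forall_eval {X : Type*} [TopologicalSpace X] [CompactSpace X]
    {F : CStarMatrix (Fin n) (Fin n) C(X, ℂ)} (hF : IsSelfAdjoint F)
    (h : ∀ (x : X) (v : Fin n → ℂ), 0 ≤ ∑ i, ∑ j, (star (v i) * v j) * F i j x) : 0 ≤ F := by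
  refine CStarAlgebra.nonneg_of_isUnit_sub hF fun r hlt => ?_
  let N : Matrix (Fin n) (Fin n) C(X, ℂ) := ofMatrix.symm ((r : ℂ) • 1 - F)
  suffices hN : IsUnit N from hN.map (ofMatrixRingEquiv (n := Fin n) (A := C(X, ℂ)))
  -- Over the commutative ring `C(X)`, invertibility of `r - F` means a nowhere vanishing
  -- determinant. A zero at `x` would give `F x` the negative eigenvalue `r`.
  rw [Matrix.isUnit_iff_isUnit_det, ContinuousMap.isUnit_iff_forall_ne_zero]
  intro x hx
  have hdet : (N.map fun f => f x).det = 0 := by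
    rw [← hx]
    exact ((ContinuousMap.evalAlgHom ℂ ℂ x).toRingHom.map_det N).symm
  obtain ⟨v, hv0, hv⟩ := Matrix.exists_mulVec_eq_zero_iff.2 hdet
  have hentry : ∀ i j, N i j x = (if i = j then (r : ℂ) else 0) - F i j x := by
    intro i j
    change (r : ℂ) * (1 : CStarMatrix (Fin n) (Fin n) C(X, ℂ)) i j x - F i j x = _
    rw [one_apply]
    split_ifs <;> simp
  have hq : ∑ i, ∑ j, (star (v i) * v j) * F i j x = r * ∑ i, star (v i) * v i := by
    have h0 : ∑ i, star (v i) * ∑ j, N i j x * v j = 0 := by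
      refine Finset.sum_eq_zero fun i _ => ?_
      have : ∑ j, N i j x * v j = 0 := congrFun hv i
      rw [this, mul_zero]
    simp only [hentry, sub_mul, Finset.sum_sub_distrib, mul_sub, ite_mul, zero_mul,
      Finset.sum_ite_eq, Finset.mem_univ, if_true] at h0
    rw [sub_eq_zero] at h0
    rw [Finset.mul_sum]
    simp only [Finset.mul_sum] at h0
    calc _ = ∑ i, ∑ j, star (v i) * (F i j x * v j) := by
          refine Finset.sum_congr rfl fun i _ => Finset.sum_congr rfl fun j _ => by ring
      _ = ∑ i, star (v i) * (r * v i) := h0.symm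
      _ = _ := Finset.sum_congr rfl fun i _ => by ring
  have h1 := h x v
  rw [hq] at h1
  have h2 : ∑ i, star (v i) * v i = ((∑ i, ‖v i‖ ^ 2 : ℝ) : ℂ) := by
    push_cast
    refine Finset.sum_congr rfl fun i _ => ?_
    exact Complex.conj_mul' (v i)
  rw [h2, ← Complex.ofReal_mul] at h1
  have h3 : 0 ≤ r * ∑ i, ‖v i‖ ^ 2 := by exact_mod_cast h1
  have h4 : 0 < ∑ i, ‖v i‖ ^ 2 := by
    obtain ⟨i, hi⟩ := Function.ne_iff.1 hv0
    exact Finset.sum_pos' (fun i _ => by positivity) ⟨i, Finset.mem_univ i, by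
      have : 0 < ‖v i‖ := norm_pos_iff.2 hi
      positivity⟩
  nlinarith

/-- Pointwise bounds on a matrix of functions bound its norm. -/
theorem norm_le_of_forall_eval {X : Type*} [TopologicalSpace X] [CompactSpace X]
    {F : CStarMatrix (Fin n) (Fin n) C(X, ℂ)} {c : ℝ} (hc : 0 ≤ c)
    (h : ∀ (x : X) (v : Fin n → ℂ),
      ∑ i, ‖∑ j, F i j x * v j‖ ^ 2 ≤ c ^ 2 * ∑ j, ‖v j‖ ^ 2) : ‖F‖ ≤ c := by
  -- The quadratic form of `c² - F* F` at `x` and `v` is `c² ‖v‖² - ‖F x v‖²`.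
  refine CStarAlgebra.norm_le_of_star_mul_self_le hc ?_
  have hsa : IsSelfAdjoint (((c ^ 2 : ℝ) : ℂ) • (1 : CStarMatrix (Fin n) (Fin n) C(X, ℂ)) -
      star F * F) := by
    rw [IsSelfAdjoint, star_sub, star_mul, star_star, star_smul, star_one, Complex.star_def,
      Complex.conj_ofReal]
  refine nonneg_of_forall_eval hsa fun x v => ?_
  have hentry : ∀ i j, (((c ^ 2 : ℝ) : ℂ) • (1 : CStarMatrix (Fin n) (Fin n) C(X, ℂ)) -
      star F * F) i j x = (if i = j then ((c ^ 2 : ℝ) : ℂ) else 0) -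
        ∑ k, star (F k i x) * F k j x := by
    intro i j
    change ((c ^ 2 : ℝ) : ℂ) * (1 : CStarMatrix (Fin n) (Fin n) C(X, ℂ)) i j x -
      (star F * F) i j x = _
    rw [one_apply, mul_apply]
    simp only [ContinuousMap.sum_apply, ContinuousMap.mul_apply, star_apply,
      ContinuousMap.star_apply]
    split_ifs <;> simp
  have hsq : ∀ z : ℂ, ((‖z‖ ^ 2 : ℝ) : ℂ) = star z * z := fun z => by
    push_cast
    exact (Complex.conj_mul' z).symm
  have : ∑ i, ∑ j, (star (v i) * v j) * ((((c ^ 2 : ℝ) : ℂ) •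
      (1 : CStarMatrix (Fin n) (Fin n) C(X, ℂ)) - star F * F) i j x) =
      ((c ^ 2 * ∑ j, ‖v j‖ ^ 2 - ∑ i, ‖∑ j, F i j x * v j‖ ^ 2 : ℝ) : ℂ) := by
    rw [Complex.ofReal_sub, Complex.ofReal_mul, Complex.ofReal_sum, Complex.ofReal_sum]
    simp only [hsq, hentry, mul_sub, Finset.sum_sub_distrib, mul_ite, mul_zero,
      Finset.sum_ite_eq, Finset.mem_univ, if_true]
    congr 1
    · rw [Finset.mul_sum]
      exact Finset.sum_congr rfl fun i _ => by ring
    · simp only [star_sum, Finset.sum_mul_sum]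
      simp only [Finset.mul_sum]
      refine (Finset.sum_congr rfl fun i _ => Finset.sum_comm).trans ?_
      rw [Finset.sum_comm]
      refine Finset.sum_congr rfl fun k _ => Finset.sum_congr rfl fun i _ =>
        Finset.sum_congr rfl fun j _ => ?_
      rw [star_mul']
      ring
  rw [this]
  exact_mod_cast sub_nonneg.2 (h x v)

-- Cauchy-Schwarz in the Hilbert module `A^n`. There `N` acts on row vectors and the pairing of `x`
-- and `y` is `∑ y x*`, whence the conjugates of `v` and `w` in the proof.
open scoped WithCStarModule InnerProductSpace in
theorem norm_sum_smul_le (N : CStarMatrix (Fin n) (Fin n) A) (w v : Fin n → ℂ) :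
    ‖∑ i, ∑ j, (star (w i) * v j) • N i j‖ ≤
      ‖N‖ * √(∑ i, ‖w i‖ ^ 2) * √(∑ j, ‖v j‖ ^ 2) := by
  let e : (Fin n → ℂ) → C⋆ᵐᵒᵈ(A, Fin n → A) := fun u =>
    (WithCStarModule.equiv A (Fin n → A)).symm fun i => u i • (1 : A)
  have he : ∀ u, ‖e u‖ ≤ √(∑ i, ‖u i‖ ^ 2) := by
    intro u
    rw [WithCStarModule.pi_norm]
    apply Real.sqrt_le_sqrt
    refine (norm_sum_le _ _).trans (Finset.sum_le_sum fun i _ => ?_)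
    change ‖(u i • (1 : A)) * star (u i • (1 : A))‖ ≤ _
    rw [CStarRing.norm_self_mul_star, ← pow_two, norm_smul]
    gcongr
    rcases subsingleton_or_nontrivial A with hA | hA
    · simp [Subsingleton.elim (1 : A) 0]
    · simp
  have hin : ⟪e (fun j => star (v j)), toCLM N (e fun i => star (w i))⟫_A =
      ∑ i, ∑ j, (star (w i) * v j) • N i j := by
    rw [toCLM_apply_eq_sum, WithCStarModule.pi_inner, Finset.sum_comm]
    refine Finset.sum_congr rfl fun j _ => ?_
    change (∑ i, (star (w i) • (1 : A)) * N i j) * star (star (v j) • (1 : A)) = _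
    simp [Finset.smul_sum, smul_smul, mul_comm]
  rw [← hin]
  refine (CStarModule.norm_inner_le _).trans ?_
  have h1 := he fun j => star (v j)
  have h2 := he fun i => star (w i)
  simp only [norm_star] at h1 h2
  calc _ ≤ √(∑ j, ‖v j‖ ^ 2) * (‖N‖ * √(∑ i, ‖w i‖ ^ 2)) := by
        refine mul_le_mul h1 (((toCLM N).le_opNorm _).trans ?_) (norm_nonneg _) (Real.sqrt_nonneg _)
        rw [← norm_def]
        gcongr
    _ = _ := by ring

end CStarMatrix

/-! ### Completely positive and completely contractive maps -/

section Approximation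

variable {X : Type*} [TopologicalSpace X] [CompactSpace X] [T2Space X]

/-- Finitely many continuous functions are approximated simultaneously by their values on a finite
set, through a partition of unity. -/
theorem exists_partition_approx {κ : Type*} [Finite κ] (M : κ → C(X, ℂ)) {ε : ℝ} (hε : 0 < ε) :
    ∃ (t : Finset X) (f : t → C(X, ℂ)), (∀ k, 0 ≤ f k) ∧ ∑ k, f k = 1 ∧
      ∀ i, ‖M i - ∑ k : t, M i k • f k‖ ≤ ε := by
  let U : X → Set X := fun x => {y | ∀ i, ‖M i y - M i x‖ < ε}
  have hUo : ∀ x, IsOpen (U x) := by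
    intro x
    simp only [U, Set.ofPred_forall]
    exact isOpen_iInter_of_finite fun i =>
      isOpen_lt ((M i).continuous.sub continuous_const).norm continuous_const
  have hxU : ∀ x, x ∈ U x := fun x i => by simpa using hε
  obtain ⟨t, ht⟩ := CompactSpace.elim_nhds_subcover U fun x => (hUo x).mem_nhds (hxU x)
  obtain ⟨p, hp⟩ := PartitionOfUnity.exists_isSubordinate (s := Set.univ) isClosed_univ
    (fun k : t => U k) (fun k => hUo k) (by
      intro x _
      have hx : x ∈ ⋃ y ∈ t, U y := by rw [ht]; trivial
      simp only [Set.mem_iUnion] at hx ⊢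
      obtain ⟨y, hy, hxy⟩ := hx
      exact ⟨⟨y, hy⟩, hxy⟩)
  let f : t → C(X, ℂ) := fun k =>
    ⟨fun x => (p k x : ℂ), Complex.continuous_ofReal.comp (p k).continuous⟩
  have hsum : ∀ x, ∑ k, p k x = 1 := fun x => by
    rw [← finsum_eq_sum_of_fintype]
    exact p.sum_eq_one (Set.mem_univ x)
  have hf1 : ∑ k, f k = 1 := by
    ext x
    rw [ContinuousMap.sum_apply, ContinuousMap.one_apply]
    change ∑ k, (p k x : ℂ) = 1
    exact_mod_cast hsum x
  refine ⟨t, f, fun k x => ?_, hf1, fun i => ?_⟩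
  · change (0 : ℂ) ≤ (p k x : ℂ)
    exact_mod_cast p.nonneg k x
  · rw [ContinuousMap.norm_le _ hε.le]
    intro x
    have h1 : (M i - ∑ k : t, M i k • f k) x = ∑ k, (p k x : ℂ) * (M i x - M i k) := by
      rw [ContinuousMap.sub_apply, ContinuousMap.sum_apply]
      simp only [mul_sub, Finset.sum_sub_distrib, ← Finset.sum_mul]
      have : ∑ k, (p k x : ℂ) = 1 := by exact_mod_cast hsum x
      rw [this, one_mul]
      congr 1
      exact Finset.sum_congr rfl fun k _ => mul_comm _ _
    rw [h1]
    calc _ ≤ ∑ k, p k x * ε := by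
          refine (norm_sum_le _ _).trans (Finset.sum_le_sum fun k _ => ?_)
          rw [norm_mul, Complex.norm_real, Real.norm_of_nonneg (p.nonneg k x)]
          by_cases hk : p k x = 0
          · simp [hk]
          · refine mul_le_mul_of_nonneg_left (le_of_lt ?_) (p.nonneg k x)
            exact hp k (subset_tsupport _ hk) i
      _ = ε := by rw [← Finset.sum_mul, hsum, one_mul]

end Approximation

section Contractive

variable {A : Type*} [CStarAlgebra A] [PartialOrder A] [StarOrderedRing A] {n : ℕ}

/-- A matrix convex combination of scalar matrices of norm at most `C` has norm at most `C`. -/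
theorem norm_sum_smul_le_of_partition {κ : Type*} [Fintype κ] (p : κ → A) (hp : ∀ k, 0 ≤ p k)
    (hp1 : ∑ k, p k = 1) (c : κ → CStarMatrix (Fin n) (Fin n) ℂ) {C : ℝ} (hC : 0 ≤ C)
    (hc : ∀ k, ‖c k‖ ≤ C) :
    ‖(CStarMatrix.ofMatrix fun i j => ∑ k, c k i j • p k :
      CStarMatrix (Fin n) (Fin n) A)‖ ≤ C := by
  classical
  -- With `q k` the square root of `p k`, the matrix is `∑ a k * d k * a k`, where `a k` is the
  -- diagonal matrix of `q k` and `d k` is the scalar matrix `c k`.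
  choose q hqsa hq using fun k => (show ∃ q : A, IsSelfAdjoint q ∧ q * q = p k from
    ⟨CFC.sqrt (p k), (CFC.sqrt_nonneg (p k)).isSelfAdjoint, CFC.sqrt_mul_sqrt_self (p k) (hp k)⟩)
  let a : κ → CStarMatrix (Fin n) (Fin n) A := fun k =>
    CStarMatrix.ofMatrix (Matrix.diagonal fun _ => q k)
  let d : κ → CStarMatrix (Fin n) (Fin n) A := fun k =>
    CStarMatrix.mapₙₐ (StarAlgHom.ofId ℂ A : ℂ →⋆ₙₐ[ℂ] A) (c k)
  have hmul : ∀ k (N : CStarMatrix (Fin n) (Fin n) A) i j,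
      (a k * N * a k) i j = q k * N i j * q k := by
    intro k N i j
    let N' : Matrix (Fin n) (Fin n) A := CStarMatrix.ofMatrix.symm N
    let Q : Matrix (Fin n) (Fin n) A := Matrix.diagonal fun _ => q k
    change (Q * N' * Q) i j = _
    rw [Matrix.mul_diagonal, Matrix.diagonal_mul]
    rfl
  have h := CStarAlgebra.norm_sum_conj_le a d (fun k => by
      ext i j
      change star (Matrix.diagonal (fun _ => q k) j i) = Matrix.diagonal (fun _ => q k) i j
      by_cases hij : i = j
      · subst hij
        simpa using (hqsa k).star_eq
      · rw [Matrix.diagonal_apply_ne _ hij, Matrix.diagonal_apply_ne' _ hij, star_zero])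
    (by
      change ∑ k, (Matrix.diagonal (fun _ => q k) * Matrix.diagonal (fun _ => q k) :
        Matrix (Fin n) (Fin n) A) = 1
      simp only [Matrix.diagonal_mul_diagonal, hq]
      ext i j
      rw [Matrix.sum_apply]
      by_cases hij : i = j
      · subst hij
        simpa using hp1
      · simp [hij])
    hC (fun k => (NonUnitalStarAlgHom.norm_apply_le _ (c k)).trans (hc k))
  refine le_trans (le_of_eq ?_) h
  congr 1
  ext i j
  let entry : CStarMatrix (Fin n) (Fin n) A →+ A := ⟨⟨fun N => N i j, rfl⟩, fun _ _ => rfl⟩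
  refine Eq.trans ?_ (map_sum entry (fun k => a k * d k * a k) Finset.univ).symm
  refine Finset.sum_congr rfl fun k _ => ?_
  refine Eq.trans ?_ (hmul k (d k) i j).symm
  change c k i j • p k = q k * algebraMap ℂ A (c k i j) * q k
  rw [Algebra.algebraMap_eq_smul_one, mul_smul_comm, mul_one, smul_mul_assoc, hq]

variable {X : Type*} [TopologicalSpace X] [CompactSpace X] [T2Space X]

/-- A unital positive map on `C(X)` is completely contractive. -/
theorem norm_map_le_of_positive (L : C(X, ℂ) →ₗ[ℂ] A) (h1 : L 1 = 1)
    (hL : ∀ f : C(X, ℂ), 0 ≤ f → 0 ≤ L f) (M : Matrix (Fin n) (Fin n) C(X, ℂ)) :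
    ‖CStarMatrix.ofMatrix (M.map L)‖ ≤ ‖CStarMatrix.ofMatrix M‖ := by
  have hLc : Continuous L := by
    let P : C(X, ℂ) →ₚ[ℂ] A := PositiveLinearMap.mk₀ L hL
    exact map_continuous P
  -- `M` is a limit of sums `∑ M(x_k) f_k` over partitions of unity. `L` carries these to
  -- combinations of the scalar matrices `M(x_k)` with weights `L f_k`, which are positive and sum
  -- to `1`.
  choose t f hf0 hf1 hf using fun m : ℕ => exists_partition_approx
    (fun ij : Fin n × Fin n => M ij.1 ij.2) (Nat.one_div_pos_of_nat (α := ℝ) (n := m))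
  let N : ℕ → CStarMatrix (Fin n) (Fin n) A := fun m =>
    CStarMatrix.ofMatrix fun i j => ∑ k : t m, M i j k • L (f m k)
  have hN : ∀ m, ‖N m‖ ≤ ‖CStarMatrix.ofMatrix M‖ := by
    intro m
    refine norm_sum_smul_le_of_partition (fun k => L (f m k)) (fun k => hL _ (hf0 m k))
      (by rw [← map_sum, hf1, h1])
      (fun k => CStarMatrix.ofMatrix fun i j => M i j k) (norm_nonneg _) fun k => ?_
    exact NonUnitalStarAlgHom.norm_apply_le (CStarMatrix.mapₙₐ (n := Fin n)
      (ContinuousMap.evalStarAlgHom ℂ ℂ (k : X) : C(X, ℂ) →⋆ₙₐ[ℂ] ℂ)) (CStarMatrix.ofMatrix M)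
  have hlim : Filter.Tendsto N Filter.atTop (nhds (CStarMatrix.ofMatrix (M.map L))) := by
    have : ∀ i j, Filter.Tendsto (fun m => ∑ k : t m, M i j k • L (f m k)) Filter.atTop
        (nhds (L (M i j))) := by
      intro i j
      have h2 : Filter.Tendsto (fun m => ∑ k : t m, M i j k • f m k) Filter.atTop
          (nhds (M i j)) := by
        rw [tendsto_iff_norm_sub_tendsto_zero]
        refine squeeze_zero (fun _ => norm_nonneg _) (fun m => ?_)
          tendsto_one_div_add_atTop_nhds_zero_nat
        rw [norm_sub_rev]
        exact hf m (i, j)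
      have h3 := (hLc.tendsto _).comp h2
      refine h3.congr fun m => ?_
      simp only [Function.comp_apply, map_sum, map_smul]
    exact tendsto_pi_nhds.2 fun i => tendsto_pi_nhds.2 fun j => this i j
  exact le_of_tendsto hlim.norm (Filter.Eventually.of_forall hN)

end Contractive

namespace OperatorSystem

variable {A B : Type*} [CStarAlgebra A] [PartialOrder A] [StarOrderedRing A]
  [CStarAlgebra B] [PartialOrder B] [StarOrderedRing B] {n : ℕ}

/-- The embedding of `A` into the `1 × 1` matrices over `A`. -/
def oneByOne (A : Type*) [CStarAlgebra A] : A →⋆ₙₐ[ℂ] CStarMatrix (Fin 1) (Fin 1) A where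
  toFun a := CStarMatrix.ofMatrix fun _ _ => a
  map_smul' _ _ := rfl
  map_zero' := rfl
  map_add' _ _ := rfl
  map_mul' a b := by
    ext i j
    rw [CStarMatrix.mul_apply, Fin.sum_univ_one]
    rfl
  map_star' _ := rfl

theorem norm_oneByOne (a : A) : ‖oneByOne A a‖ = ‖a‖ :=
  le_antisymm (NonUnitalStarAlgHom.norm_apply_le (oneByOne A) a)
    (CStarMatrix.norm_entry_le_norm (M := oneByOne A a) (i := 0) (j := 0))

theorem norm_eq_of_completelyIsometric {S : OperatorSystem A} {T : OperatorSystem B}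
    {φ : S.Space →ₗ[ℂ] T.Space} (hφ : IsCompletelyIsometric φ) (x : S.Space) :
    ‖φ x‖ = ‖x‖ :=
  (norm_oneByOne (φ x : B)).symm.trans ((hφ 1 fun _ _ => x).trans (norm_oneByOne (x : A)))

theorem isPositive_of_completelyPositive {S : OperatorSystem A} {T : OperatorSystem B}
    {φ : S.Space →ₗ[ℂ] T.Space} (hφ : IsCompletelyPositive φ) : IsPositive φ := by
  intro x hx
  have h := CStarMatrix.sum_smul_nonneg (hφ 1 (fun _ _ => x) (by
    obtain ⟨b, hb⟩ := CStarAlgebra.exists_eq_star_mul_self hx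
    have : S.toCStarMatrix (fun _ _ : Fin 1 => x) = star (oneByOne A b) * oneByOne A b := by
      rw [← map_star, ← map_mul, ← hb]
      rfl
    rw [this]
    exact star_mul_self_nonneg _)) 1
  rw [Fin.sum_univ_one, Fin.sum_univ_one, Pi.one_apply, star_one, mul_one, one_smul] at h
  exact h

end OperatorSystem

/-! ### Positivity and norms of maps into `C(X)` -/

section IntoFunctions

open OperatorSystem GOperatorSystem

variable {A : Type*} [CStarAlgebra A] [PartialOrder A] [StarOrderedRing A]
  {G : Type*} [Group G] {X : Type*} [TopologicalSpace X] [CompactSpace X] [MulAction G X]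
  [ContinuousConstSMul G X]

/-- The functional `y ↦ ψ y x`. -/
noncomputable def evalAt {S : OperatorSystem A} (ψ : S.Space →ₗ[ℂ] (ofSpace G X).Space) (x : X) :
    S.Space →ₗ[ℂ] ℂ :=
  (ContinuousMap.evalAlgHom ℂ ℂ x).toLinearMap ∘ₗ Submodule.subtype _ ∘ₗ ψ

/-- A unital positive map into `C(X)` is completely positive. -/
theorem isCompletelyPositive_of_positive {S : OperatorSystem A}
    (ψ : S.Space →ₗ[ℂ] (ofSpace G X).Space) (h1 : IsUnital (T := (ofSpace G X).toOperatorSystem) ψ)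
    (hψ : IsPositive (T := (ofSpace G X).toOperatorSystem) ψ) :
    IsCompletelyPositive (T := (ofSpace G X).toOperatorSystem) ψ := by
  intro n M hM
  have he1 : ∀ x, evalAt ψ x S.unit = 1 := fun x =>
    congrArg (fun f : (ofSpace G X).Space => (f : C(X, ℂ)) x) h1
  have hepos : ∀ x (y : S.Space), 0 ≤ (y : A) → 0 ≤ evalAt ψ x y := fun x y hy => hψ y hy x
  refine CStarMatrix.nonneg_of_forall_eval ?_ fun x v => ?_
  · ext i j x
    have hMsa : star (S.toCStarMatrix M) = S.toCStarMatrix M := (IsSelfAdjoint.of_nonneg hM)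
    have h2 : star ((M j i : A)) = M i j := congrArg (fun N : CStarMatrix _ _ A => N i j) hMsa
    have h3 : (⟨star (M j i : A), S.star_mem' (M j i).2⟩ : S.Space) = M i j := Subtype.ext h2
    change star (evalAt ψ x (M j i)) = evalAt ψ x (M i j)
    rw [← map_star_of_positive S (evalAt ψ x) (he1 x) (hepos x), h3]
  -- The quadratic form of the image at `x` is a positive functional applied to the positive element
  -- `∑ v̄_i v_j M_ij` of `S`.
  · have h2 := CStarMatrix.sum_smul_nonneg hM v
    have h3 := hepos x (∑ i, ∑ j, (star (v i) * v j) • M i j) (by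
      refine h2.trans (le_of_eq ?_)
      simp [toCStarMatrix])
    rw [map_sum] at h3
    simp only [map_sum, map_smul, smul_eq_mul] at h3
    exact h3

/-- A matrix of functions obtained from a matrix over an operator system by applying states at
every point has smaller norm. -/
theorem norm_le_of_states (S : OperatorSystem A) {n : ℕ} (M : Matrix (Fin n) (Fin n) C(X, ℂ))
    (N : Matrix (Fin n) (Fin n) S.Space) (ω : X → S.Space → ℂ) (hω : ∀ x, ω x ∈ S.states)
    (h : ∀ x i j, ω x (N i j) = M i j x) : ‖CStarMatrix.ofMatrix M‖ ≤ ‖S.toCStarMatrix N‖ := by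
  refine CStarMatrix.norm_le_of_forall_eval (norm_nonneg _) fun x v => ?_
  -- With `y = M(x) v`, the number `‖y‖²` is the state `ω x` at `∑ ȳ_i v_j N_ij`, hence at most `‖N‖
  -- ‖y‖ ‖v‖`; then `‖y‖` is cancelled.
  set y : Fin n → ℂ := fun i => ∑ j, M i j x * v j with hy
  let L := stateSet.toLinearMap (hω x)
  have hL : ∀ i j, L (N i j) = M i j x := h x
  have h1 : L (∑ i, ∑ j, (star (y i) * v j) • N i j) = ((∑ i, ‖y i‖ ^ 2 : ℝ) : ℂ) := by
    rw [map_sum, Complex.ofReal_sum]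
    refine Finset.sum_congr rfl fun i _ => ?_
    rw [map_sum]
    simp only [map_smul, hL, smul_eq_mul]
    rw [Complex.ofReal_pow, ← Complex.conj_mul' (y i)]
    conv_rhs => rw [hy]
    rw [Finset.mul_sum]
    refine Finset.sum_congr rfl fun j _ => ?_
    change star (y i) * v j * M i j x = star (y i) * (M i j x * v j)
    ring
  have h2 : ‖L (∑ i, ∑ j, (star (y i) * v j) • N i j)‖ ≤
      ‖S.toCStarMatrix N‖ * √(∑ i, ‖y i‖ ^ 2) * √(∑ j, ‖v j‖ ^ 2) := by
    refine ((hω x).2.2.2.2 _).trans ?_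
    refine le_trans (le_of_eq ?_) (CStarMatrix.norm_sum_smul_le (S.toCStarMatrix N) y v)
    refine congrArg norm (a₁ := ((∑ i, ∑ j, (star (y i) * v j) • N i j : S.Space) : A)) ?_
    rw [Submodule.coe_sum]
    refine Finset.sum_congr rfl fun i _ => ?_
    rw [Submodule.coe_sum]
    rfl
  have hY : 0 ≤ ∑ i, ‖y i‖ ^ 2 := Finset.sum_nonneg fun i _ => by positivity
  have hV : 0 ≤ ∑ i, ‖v i‖ ^ 2 := Finset.sum_nonneg fun i _ => by positivity
  rw [h1, Complex.norm_real, Real.norm_of_nonneg hY] at h2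
  set a := √(∑ i, ‖y i‖ ^ 2) with ha
  set b := √(∑ j, ‖v j‖ ^ 2) with hb
  have ha2 : ∑ i, ‖y i‖ ^ 2 = a ^ 2 := (Real.sq_sqrt hY).symm
  have hb2 : ∑ i, ‖v i‖ ^ 2 = b ^ 2 := (Real.sq_sqrt hV).symm
  change ∑ i, ‖y i‖ ^ 2 ≤ _
  rw [ha2, hb2]
  rw [ha2] at h2
  have ha0 : 0 ≤ a := Real.sqrt_nonneg _
  have hb0 : 0 ≤ b := Real.sqrt_nonneg _
  have h4 : a ≤ ‖S.toCStarMatrix N‖ * b := by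
    rcases ha0.eq_or_lt with h0 | h0
    · rw [← h0]; positivity
    · refine le_of_mul_le_mul_right ?_ h0
      linarith
  calc a ^ 2 ≤ (‖S.toCStarMatrix N‖ * b) ^ 2 := pow_le_pow_left₀ ha0 h4 2
    _ = _ := by ring

end IntoFunctions

/-! ### Injectivity of the algebra of the Furstenberg boundary -/

section Main

attribute [local instance] translateAction

open OperatorSystem GOperatorSystem

theorem isCompact_of_isClosed_of_bounded {I : Type*} {K : Set (I → ℂ)} (hK : IsClosed K) (r : I → ℝ)
    (hr : ∀ k ∈ K, ∀ i, ‖k i‖ ≤ r i) : IsCompact K := by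
  refine (isCompact_univ_pi fun i : I => isCompact_closedBall (0 : ℂ) (r i)).of_isClosed_subset
    hK fun k hk i _ => ?_
  simpa using hr k hk i

section

variable {G : Type u} [Group G] {X : Type v} [TopologicalSpace X] [MulAction G X]
  [ContinuousConstSMul G X]

theorem isUnitalPositiveEquivariant_id :
    IsUnitalPositiveEquivariant G (LinearMap.id : C(X, ℂ) →ₗ[ℂ] C(X, ℂ)) :=
  ⟨rfl, fun _ hf => hf, fun _ _ => rfl⟩

theorem isUnitalPositiveEquivariant_comp {Y : Type*} [TopologicalSpace Y] [MulAction G Y]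
    [ContinuousConstSMul G Y] (p : C(X, Y)) (hp : ∀ (s : G) (x : X), p (s • x) = s • p x) :
    IsUnitalPositiveEquivariant G (p.compRightAlgHom ℂ ℂ).toLinearMap :=
  ⟨rfl, fun _ hf x => hf (p x), fun s f => by
    ext x
    change f (s⁻¹ • p x) = f (p (s⁻¹ • x))
    rw [hp]⟩

/-- The only equivariant map from a boundary to its own states is evaluation. -/
theorem IsGBoundary.eq_eval_of_states [CompactSpace X] (hX : IsGBoundary G X)
    {Φ : X → C(X, ℂ) → ℂ} (hΦc : Continuous Φ) (hΦ : ∀ x, Φ x ∈ functionStates X)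
    (hΦG : ∀ (s : G) (x : X), Φ (s • x) = s • Φ x) (x : X) (f : C(X, ℂ)) : Φ x f = f x := by
  have := hX.nonempty
  have := hX.minimal
  obtain ⟨p, hpc, -, hpG, hp⟩ := hX.exists_map_of_states hΦc hΦ hΦG
  -- Composition with `p` and the identity are both positive equivariant maps, so they coincide.
  have h := hX.unique_map (isUnitalPositiveEquivariant_comp (G := G) ⟨p, hpc⟩ hpG)
    isUnitalPositiveEquivariant_id
  rw [hp x]
  exact congrArg (fun φ : C(X, ℂ) →ₗ[ℂ] C(X, ℂ) => φ f x) h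

/-- A compact convex `G`-space of pairs of a function and a state of `C(X)` admits an equivariant
map from the Furstenberg boundary `X` that is evaluation in the second coordinate. -/
theorem IsFurstenbergBoundary.exists_section [CompactSpace X] (hX : IsFurstenbergBoundary G X)
    {J : Type*} [MulAction G J] {K : Set (J ⊕ C(X, ℂ) → ℂ)} (hK : IsConvexGSet G K)
    (hKs : ∀ k ∈ K, (fun f => k (Sum.inr f)) ∈ functionStates X) :
    ∃ F : X → J ⊕ C(X, ℂ) → ℂ, Continuous F ∧ (∀ x, F x ∈ K) ∧
      (∀ (s : G) (x : X), F (s • x) = s • F x) ∧ ∀ x f, F x (Sum.inr f) = f x := by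
  obtain ⟨F, hFc, hFK, hFG⟩ := hX.exists_map_convex hK
  refine ⟨F, hFc, hFK, hFG, ?_⟩
  exact hX.isGBoundary.eq_eval_of_states (Φ := fun x f => F x (Sum.inr f))
    (continuous_pi fun f => (continuous_apply _).comp hFc) (fun x => hKs _ (hFK x))
    (fun s x => by
      funext f
      rw [hFG]
      rfl)

end

/-- The action of `G` on a `G`-operator system. -/
noncomputable abbrev GOperatorSystem.mulAction {G : Type*} [Group G] {A : Type*} [CStarAlgebra A]
    [PartialOrder A] (S : GOperatorSystem G A) : MulAction G S.Space where
  smul s x := S.act s x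
  one_smul x := by
    change S.act 1 x = x
    rw [map_one]
    rfl
  mul_smul s t x := by
    change S.act (s * t) x = S.act s (S.act t x)
    rw [map_mul]
    rfl

/-- The map into `C(X)` given by a continuous family of states. -/
noncomputable def ofStates {B : Type*} [CStarAlgebra B] [PartialOrder B] (T : OperatorSystem B)
    (G : Type*) [Group G] {X : Type*} [TopologicalSpace X] [CompactSpace X] [MulAction G X]
    [ContinuousConstSMul G X] (ω : X → T.Space → ℂ) (hωc : Continuous ω)
    (hω : ∀ x, ω x ∈ T.states) : T.Space →ₗ[ℂ] (ofSpace G X).Space where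
  toFun y := ⟨⟨fun x => ω x y, (continuous_apply y).comp hωc⟩, trivial⟩
  map_add' y z := Subtype.ext (ContinuousMap.ext fun x => (hω x).1 y z)
  map_smul' c y := Subtype.ext (ContinuousMap.ext fun x => (hω x).2.1 c y)

section

variable {B : Type*} [CStarAlgebra B] [PartialOrder B] (T : OperatorSystem B)
  (G : Type*) [Group G] {X : Type*} [TopologicalSpace X] [CompactSpace X] [MulAction G X]
  [ContinuousConstSMul G X] (ω : X → T.Space → ℂ) (hωc : Continuous ω) (hω : ∀ x, ω x ∈ T.states)

theorem isUnital_ofStates :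
    IsUnital (T := (ofSpace G X).toOperatorSystem) (ofStates T G ω hωc hω) :=
  Subtype.ext (ContinuousMap.ext fun x => (hω x).2.2.1)

theorem isCompletelyPositive_ofStates [StarOrderedRing B] :
    IsCompletelyPositive (T := (ofSpace G X).toOperatorSystem) (ofStates T G ω hωc hω) :=
  isCompletelyPositive_of_positive _ (isUnital_ofStates T G ω hωc hω)
    fun y hy x => (hω x).2.2.2.1 y hy

end

variable {G : Type u} [Group G] {X : Type v} [TopologicalSpace X] [CompactSpace X]
  [MulAction G X] [ContinuousConstSMul G X]

theorem evalAt_unit {A : Type*} [CStarAlgebra A] [PartialOrder A] [StarOrderedRing A]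
    {S : OperatorSystem A} {ψ : S.Space →ₗ[ℂ] (ofSpace G X).Space}
    (hψ1 : IsUnital (T := (ofSpace G X).toOperatorSystem) ψ) (x : X) : evalAt ψ x S.unit = 1 :=
  congrArg (fun f : (ofSpace G X).Space => (f : C(X, ℂ)) x) hψ1

/-- `K` consists of the pairs of states of `T` and of `C(X)` that agree through `ι` and `ψ`. In an
equivariant map from `X` to `K`, rigidity makes the second coordinate evaluation, so the first one
extends `ψ`. -/
theorem IsFurstenbergBoundary.isGInjective (hX : IsFurstenbergBoundary G X) :
    (ofSpace G X).IsGInjective.{u, v, w₁, w₂} := by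
  intro A _ _ _ B _ _ _ S T ι ψ hι1 hι hιG hψ1 hψ hψG
  let : MulAction G T.Space := T.mulAction
  have hψpos := isPositive_of_completelyPositive hψ
  let K : Set (T.Space ⊕ C(X, ℂ) → ℂ) :=
    {k | (fun t => k (Sum.inl t)) ∈ T.states ∧ (fun f => k (Sum.inr f)) ∈ functionStates X ∧
      ∀ y, k (Sum.inl (ι y)) = k (Sum.inr (ψ y))}
  have hKcl : IsClosed K := by
    refine IsClosed.and ?_ (IsClosed.and ?_ ?_)
    · exact isClosed_stateSet.preimage (continuous_pi fun t => continuous_apply (Sum.inl t))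
    · exact isClosed_stateSet.preimage (continuous_pi fun f => continuous_apply (Sum.inr f))
    · simp only [Set.ofPred_forall]
      exact isClosed_iInter fun y => isClosed_eq (continuous_apply _) (continuous_apply _)
  have hK : IsConvexGSet G K := by
    refine ⟨?_, ?_, ?_, ?_⟩
    · obtain ⟨x⟩ := hX.isGBoundary.nonempty
      obtain ⟨L, hL1, hLpos, hLι⟩ := exists_state_extension S.toOperatorSystem T.toOperatorSystem ι
        hι1 (norm_eq_of_completelyIsometric hι) (evalAt ψ x) (evalAt_unit hψ1 x)
        fun y hy => hψpos y hy x
      exact ⟨Sum.elim L fun f => f x, T.mem_states L hL1 hLpos, eval_mem_functionStates x, hLι⟩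
    · refine isCompact_of_isClosed_of_bounded hKcl (Sum.elim (fun t => ‖t‖) fun f => ‖f‖) ?_
      rintro k hk (t | f)
      · exact hk.1.2.2.2.2 t
      · exact hk.2.1.2.2.2.2 f
    · intro k hk l hl a b ha hb hab
      refine ⟨convex_stateSet hk.1 hl.1 ha hb hab, convex_stateSet hk.2.1 hl.2.1 ha hb hab,
        fun y => ?_⟩
      simp only [Pi.add_apply, Pi.smul_apply, hk.2.2, hl.2.2]
    · intro s k hk
      have hkι : ∀ y, k (Sum.inl (T.act s⁻¹ (ι y))) = k (Sum.inr (translateFun s⁻¹ (ψ y).1)) := by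
        intro y
        rw [← hιG, hk.2.2, hψG]
        rfl
      refine ⟨?_, smul_mem_functionStates s hk.2.1, hkι⟩
      refine T.mem_states (stateSet.toLinearMap hk.1 ∘ₗ T.act s⁻¹) ?_ fun t ht =>
        hk.1.2.2.2.1 _ (T.act_nonneg s⁻¹ t ht)
      -- The action on `T` is not assumed to fix the unit. That the translated functional is unital
      -- is read off from compatibility at `S.unit`, as translation fixes the constant `1` in
      -- `C(X)`.
      have h1 := hkι S.unit
      rw [hι1, hψ1] at h1
      exact h1.trans hk.2.1.2.2.1
  obtain ⟨F, hFc, hFK, hFG, hFe⟩ := hX.exists_section hK fun k hk => hk.2.1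
  have hωc : Continuous fun (x : X) (t : T.Space) => F x (Sum.inl t) :=
    continuous_pi fun t => (continuous_apply _).comp hFc
  have hω : ∀ x, (fun t => F x (Sum.inl t)) ∈ T.states := fun x => (hFK x).1
  refine ⟨ofStates T.toOperatorSystem G _ hωc hω, isUnital_ofStates _ G _ hωc hω,
    isCompletelyPositive_ofStates _ G _ hωc hω, fun s t => ?_, ?_⟩
  · refine Subtype.ext (ContinuousMap.ext fun x => ?_)
    change F x (Sum.inl (T.act s t)) = F (s⁻¹ • x) (Sum.inl t)
    rw [hFG]
    change _ = F x (Sum.inl (T.act s⁻¹⁻¹ t))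
    rw [inv_inv]
  · refine LinearMap.ext fun y => Subtype.ext (ContinuousMap.ext fun x => ?_)
    exact ((hFK x).2.2 y).trans (hFe x _)

/-- Without an action on `T`, a single state is replaced by a family indexed by `G`, on which `G`
acts by translating the index. The member at `g` must be compatible with the translate of `ψ` by
`g`, and the member at `1` gives the extension. -/
theorem IsFurstenbergBoundary.isInjective (hX : IsFurstenbergBoundary G X) :
    (ofSpace G X).toOperatorSystem.IsInjective.{v, w₁, w₂} := by
  intro A _ _ _ B _ _ _ S T ι ψ hι1 hι hψ1 hψ
  let : MulAction G (G × T.Space) :=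
    { smul := fun s gt => (s * gt.1, gt.2)
      one_smul := fun gt => Prod.ext (one_mul _) rfl
      mul_smul := fun s t gt => Prod.ext (mul_assoc _ _ _) rfl }
  have hψpos := isPositive_of_completelyPositive hψ
  let K : Set ((G × T.Space) ⊕ C(X, ℂ) → ℂ) :=
    {k | (∀ g : G, (fun t => k (Sum.inl (g, t))) ∈ T.states) ∧
      (fun f => k (Sum.inr f)) ∈ functionStates X ∧
      ∀ (g : G) y, k (Sum.inl (g, ι y)) = k (Sum.inr (g • (ψ y).1))}
  have hKcl : IsClosed K := by
    refine IsClosed.and ?_ (IsClosed.and ?_ ?_)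
    · simp only [Set.ofPred_forall]
      exact isClosed_iInter fun g => isClosed_stateSet.preimage
        (continuous_pi fun t => continuous_apply (Sum.inl (g, t)))
    · exact isClosed_stateSet.preimage (continuous_pi fun f => continuous_apply (Sum.inr f))
    · simp only [Set.ofPred_forall]
      exact isClosed_iInter fun g => isClosed_iInter fun y =>
        isClosed_eq (continuous_apply _) (continuous_apply _)
  have hK : IsConvexGSet G K := by
    refine ⟨?_, ?_, ?_, ?_⟩
    · obtain ⟨x⟩ := hX.isGBoundary.nonempty
      choose L hL1 hLpos hLι using fun g : G => exists_state_extension S T ι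
        hι1 (norm_eq_of_completelyIsometric hι) (evalAt ψ (g⁻¹ • x)) (evalAt_unit hψ1 _)
        fun y hy => hψpos y hy _
      exact ⟨Sum.elim (fun gt => L gt.1 gt.2) fun f => f x,
        fun g => T.mem_states (L g) (hL1 g) (hLpos g), eval_mem_functionStates x, hLι⟩
    · refine isCompact_of_isClosed_of_bounded hKcl (Sum.elim (fun gt => ‖gt.2‖) fun f => ‖f‖) ?_
      rintro k hk (⟨g, t⟩ | f)
      · exact (hk.1 g).2.2.2.2 t
      · exact hk.2.1.2.2.2.2 f
    · intro k hk l hl a b ha hb hab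
      refine ⟨fun g => convex_stateSet (hk.1 g) (hl.1 g) ha hb hab,
        convex_stateSet hk.2.1 hl.2.1 ha hb hab, fun g y => ?_⟩
      simp only [Pi.add_apply, Pi.smul_apply, hk.2.2, hl.2.2]
    · intro s k hk
      refine ⟨fun g => hk.1 (s⁻¹ * g), smul_mem_functionStates s hk.2.1, fun g y => ?_⟩
      refine (hk.2.2 (s⁻¹ * g) y).trans ?_
      rw [mul_smul]
      rfl
  obtain ⟨F, hFc, hFK, hFG, hFe⟩ := hX.exists_section hK fun k hk => hk.2.1
  have hωc : Continuous fun (x : X) (t : T.Space) => F x (Sum.inl (1, t)) :=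
    continuous_pi fun t => (continuous_apply _).comp hFc
  have hω : ∀ x, (fun t => F x (Sum.inl (1, t))) ∈ T.states := fun x => (hFK x).1 1
  refine ⟨ofStates T G _ hωc hω, isUnital_ofStates _ G _ hωc hω,
    isCompletelyPositive_ofStates _ G _ hωc hω, ?_⟩
  refine LinearMap.ext fun y => Subtype.ext (ContinuousMap.ext fun x => ?_)
  refine ((hFK x).2.2 1 y).trans ((hFe x _).trans ?_)
  rw [one_smul]

/-- The identity of `ℂ` extends along `c ↦ c • 1`, which is isometric because `A` is nontrivial. -/
theorem OperatorSystem.states_nonempty {A : Type*} [CStarAlgebra A] [Nontrivial A] [PartialOrder A]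
    [StarOrderedRing A] (S : OperatorSystem A) : S.states.Nonempty := by
  let ι : (whole ℂ).Space →ₗ[ℂ] S.Space :=
    (LinearMap.toSpanSingleton ℂ S.Space S.unit) ∘ₗ Submodule.subtype _
  obtain ⟨L, hL1, hLpos, -⟩ := exists_state_extension (whole ℂ) S ι (one_smul ℂ S.unit)
    (fun c => by
      change ‖(c : ℂ) • (1 : A)‖ = ‖(c : ℂ)‖
      rw [norm_smul, norm_one, mul_one]) (Submodule.subtype _) rfl fun _ h => h
  exact ⟨L, S.mem_states L hL1 hLpos⟩

/-- An equivariant map from `X` to the states of `S`, composed with `φ`, is evaluation by rigidity.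
So these states recover a matrix of functions from its image, and `φ` cannot decrease norms;
positivity keeps it from increasing them. -/
theorem IsFurstenbergBoundary.isCompletelyIsometric (hX : IsFurstenbergBoundary G X) {A : Type*}
    [CStarAlgebra A] [Nontrivial A] [PartialOrder A] [StarOrderedRing A] (S : GOperatorSystem G A)
    (φ : (ofSpace G X).Space →ₗ[ℂ] S.Space)
    (h1 : IsUnital (S := (ofSpace G X).toOperatorSystem) (T := S.toOperatorSystem) φ)
    (hφ : IsPositive (S := (ofSpace G X).toOperatorSystem) (T := S.toOperatorSystem) φ)
    (hφG : IsEquivariant φ) :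
    IsCompletelyIsometric (S := (ofSpace G X).toOperatorSystem) (T := S.toOperatorSystem) φ := by
  have := hX.isGBoundary.t2
  let : MulAction G S.Space := S.mulAction
  -- The unit of `S` is the image of the invariant function `1`, so `G` fixes it and acts on the
  -- states.
  have hunit : ∀ s : G, S.act s S.unit = S.unit := by
    intro s
    rw [← h1, ← hφG]
    rfl
  have hK : IsConvexGSet G S.states := by
    refine ⟨S.states_nonempty, isCompact_stateSet, convex_stateSet, fun s l hl => ?_⟩
    refine S.mem_states (stateSet.toLinearMap hl ∘ₗ S.act s⁻¹) ?_ fun t ht =>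
      hl.2.2.2.1 _ (S.act_nonneg s⁻¹ t ht)
    change l (S.act s⁻¹ S.unit) = 1
    rw [hunit]
    exact hl.2.2.1
  obtain ⟨ω, hωc, hω, hωG⟩ := hX.exists_map_convex hK
  let incl : C(X, ℂ) →ₗ[ℂ] (ofSpace G X).Space :=
    { toFun := fun f => ⟨f, trivial⟩
      map_add' := fun _ _ => rfl
      map_smul' := fun _ _ => rfl }
  have hωφ := hX.isGBoundary.eq_eval_of_states (Φ := fun x f => ω x (φ (incl f)))
    (continuous_pi fun f => (continuous_apply _).comp hωc)
    (fun x => mem_functionStates (stateSet.toLinearMap (hω x) ∘ₗ φ ∘ₗ incl)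
      ((congrArg (ω x) h1).trans (hω x).2.2.1) fun f hf => (hω x).2.2.2.1 _ (hφ _ hf))
    (fun s x => by
      funext f
      rw [hωG]
      change ω x (S.act s⁻¹ (φ (incl f))) = ω x (φ (incl (translateFun s⁻¹ f)))
      rw [← hφG]
      rfl)
  intro n M
  apply le_antisymm
  · exact norm_map_le_of_positive (Submodule.subtype _ ∘ₗ φ ∘ₗ incl) (congrArg Subtype.val h1)
      (fun f hf => hφ _ hf) (M.map fun f => (f : C(X, ℂ)))
  · exact norm_le_of_states S.toOperatorSystem (M.map fun f => (f : C(X, ℂ))) (M.map φ) ω hω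
      fun x i j => hωφ x (M i j)

end Main

theorem mainTheorem9 (G : Type u) [Group G] :
    (∃ (X : Type u) (_ : TopologicalSpace X) (_ : MulAction G X) (_ : ContinuousConstSMul G X),
      IsFurstenbergBoundary G X) ∧
    ∀ (X : Type v) [TopologicalSpace X] [CompactSpace X] [MulAction G X]
      [ContinuousConstSMul G X], IsFurstenbergBoundary G X →
      (GOperatorSystem.ofSpace G X).IsGInjective.{u, v, w₁, w₂} ∧
      (GOperatorSystem.ofSpace G X).toOperatorSystem.IsInjective.{v, w₁, w₂} ∧
      (∀ (A : Type w₃) [CStarAlgebra A] [Nontrivial A] [PartialOrder A] [StarOrderedRing A]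
        (S : GOperatorSystem G A) (φ : (GOperatorSystem.ofSpace G X).Space →ₗ[ℂ] S.Space),
        OperatorSystem.IsUnital φ → OperatorSystem.IsPositive φ →
        GOperatorSystem.IsEquivariant φ → OperatorSystem.IsCompletelyIsometric φ) ∧
      (∀ φ : C(X, ℂ) →ₗ[ℂ] C(X, ℂ), IsUnitalPositiveEquivariant G φ ↔ φ = LinearMap.id) ∧
      (∀ (B : Type w₄) [TopologicalSpace B] [MulAction G B] [ContinuousConstSMul G B],
        IsGBoundary G B →
        (∃! φ : C(B, ℂ) →ₗ[ℂ] C(X, ℂ), IsUnitalPositiveEquivariant G φ) ∧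
        ∀ φ : C(B, ℂ) →ₗ[ℂ] C(X, ℂ), IsUnitalPositiveEquivariant G φ → IsInjectiveStarHom φ) ∧
      (∀ (M : Type w₅) [TopologicalSpace M] [CompactSpace M] [T2Space M] [Nonempty M]
        [MulAction G M] [ContinuousConstSMul G M] [MulAction.IsMinimal G M],
        (∀ φ ψ : C(X, ℂ) →ₗ[ℂ] C(M, ℂ), IsUnitalPositiveEquivariant G φ →
          IsUnitalPositiveEquivariant G ψ → φ = ψ) ∧
        ∀ φ : C(X, ℂ) →ₗ[ℂ] C(M, ℂ), IsUnitalPositiveEquivariant G φ → IsInjectiveStarHom φ) := by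
  refine ⟨exists_furstenbergBoundary G, fun X _ _ _ _ hX => ?_⟩
  have hXb := hX.isGBoundary
  have := hXb.nonempty
  have := hXb.minimal
  refine ⟨hX.isGInjective, hX.isInjective, fun A _ _ _ _ S φ h1 hφ hφG =>
    hX.isCompletelyIsometric S φ h1 hφ hφG, fun φ => ⟨fun hφ =>
      hXb.unique_map hφ isUnitalPositiveEquivariant_id, ?_⟩, fun B _ _ _ hB => ?_,
    fun M _ _ _ _ _ _ _ => ⟨fun φ ψ hφ hψ => hXb.unique_map hφ hψ,
      fun φ hφ => hXb.isInjectiveStarHom hφ⟩⟩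
  · rintro rfl
    exact isUnitalPositiveEquivariant_id
  · have := hB.compact
    obtain ⟨p, hpc, -, hpG⟩ := hX.exists_map hB
    have hp := isUnitalPositiveEquivariant_comp (G := G) ⟨p, hpc⟩ hpG
    exact ⟨⟨_, hp, fun φ hφ => hB.unique_map hφ hp⟩, fun φ hφ => hB.isInjectiveStarHom hφ⟩
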